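/- Let $\mathcal H$ be a complex Hilbert space. For a measurable space $X$, a POVM on $X$ is a map $F$ from the measurable subsets of $X$ to the positive bounded operators on $\mathcal H$ that is countably additive in the weak operator topology; it is normalized if $F(X)=\mathbf 1$, commutative if $F(\Delta_1)F(\Delta_2)=F(\Delta_2)F(\Delta_1)$ for all measurable $\Delta_1,\Delta_2$, and a PVM if it is normalized and $F(\Delta_1)F(\Delta_2)=\mathbf 0$ whenever $\Delta_1\cap\Delta_2=\emptyset$. One writes $B=\int_\Gamma f\,dF$ if $\langle Bx,x\rangle=\int_\Gamma f\,d\langle F(\cdot)x,x\rangle$ for all $x\in\mathcal H$. A map $\mu:\Lambda\times\mathcal B(\mathbb R)\to[0,1]$, $(\lambda,\Delta)\mapsto\mu_\Delta(\lambda)$, with $\Lambda$ a measurable space, is a Markov kernel if $\mu_\Delta$ is measurable for every Borel $\Delta$ and $\mu_{(\cdot)}(\lambda)$ is a probability measure for every $\lambda\in\Lambda$. If $\Lambda$ is a topological space with its Borel $\sigma$-algebra, a Markov kernel is Feller if $\lambda\mapsto\int_{\mathbb R} f(t)\,\mu_{(dt)}(\lambda)$ is continuous and bounded on $\Lambda$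 for every bounded continuous $f:\mathbb R\to\mathbb R$. For a PVM $E$ on $\Lambda$, $\mu$ is a weak Markov kernel with respect to $E$ if each $\mu_\Delta$ is measurable and, almost everywhere with respect to each of the measures $\langle E(\cdot)x,x\rangle$, $x\in\mathcal H$, one has $\mu_{\mathbb R}=1$, $\mu_\emptyset=0$ and, for each sequence $(\Delta_i)$ of pairwise disjoint Borel sets, $\sum_i\mu_{\Delta_i}=\mu_{\bigcup_i\Delta_i}$ (the exceptional null set may depend on the sequence). A strong Markov kernel $(\mu,E,\Gamma\subset\Lambda)$ is a weak Markov kernel $\mu$ with respect to $E$ together with a measurable set $\Gamma\subset\Lambda$ such that $E(\Gamma)=\mathbf 1$ and the restriction of $\mu$ to $\Gamma\times\mathcal B(\mathbb R)$ is a Markov kernel. Let $\mathcal R(\mathcal S)$ be the ring of sets generated by the family $\mathcal S$ of the open intervals $(a,b)$ with $a,b\in\mathbb Q$. **Theorem.** A normalized POVM $F$ on $\mathcal B(\mathbb R)$ is commutative if and only if there are a bounded self-adjoint operator $A$ on $\mathcal H$ with spectrum $\sigma(A)\subset[0,1]$, a PVM $E$ on $\mathcal B(\sigma(A))$ with $A=\int_{\sigma(A)}\lambda\,dE_\lambda$,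 and a strong Markov kernel $(\mu,E,\Gamma\subset\sigma(A))$ such that 1. $\mu_\Delta:\sigma(A)\to[0,1]$ is continuous for each $\Delta\in\mathcal R(\mathcal S)$; 2. $F(\Delta)=\int_\Gamma\mu_\Delta(\lambda)\,dE_\lambda$ for each $\Delta\in\mathcal B(\mathbb R)$; 3. $\mu$ separates the points of $\Gamma$: for $\lambda\ne\lambda'$ in $\Gamma$ there is a Borel set $\Delta$ with $\mu_\Delta(\lambda)\neq\mu_\Delta(\lambda')$. Moreover, for all such $A$, $E$, $\mu$ and $\Gamma$, the restriction $\mu:\Gamma\times\mathcal B(\mathbb R)\to[0,1]$ is a Feller Markov kernel. -/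

import Mathlib

open MeasureTheory ProbabilityTheory

noncomputable section

/-- A positive operator valued measure on a measurable space: a map from the measurable sets to
the positive bounded operators which is countably additive in the weak operator topology.
(Values on non-measurable sets are irrelevant and are never used.) -/
structure POVM (α : Type*) [MeasurableSpace α] (H : Type*) [NormedAddCommGroup H]
    [InnerProductSpace ℂ H] [CompleteSpace H] where
  /-- the operator attached to a set -/
  toFun : Set α → (H →L[ℂ] H)
  isPositive : ∀ Δ : Set α, MeasurableSet Δ → (toFun Δ).IsPositive
  hasSum_iUnion : ∀ Δ : ℕ → Set α, (∀ n, MeasurableSet (Δ n)) →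
    Pairwise (fun i j => Disjoint (Δ i) (Δ j)) →
    ∀ x y : H, HasSum (fun n => inner ℂ (toFun (Δ n) x) y) (inner ℂ (toFun (⋃ n, Δ n) x) y)

namespace POVM

variable {α : Type*} [MeasurableSpace α] {H : Type*} [NormedAddCommGroup H]
  [InnerProductSpace ℂ H] [CompleteSpace H]

instance : CoeFun (POVM α H) (fun _ => Set α → (H →L[ℂ] H)) := ⟨POVM.toFun⟩

/-- `F` is normalized if the whole space has measure `1`. -/
def IsNormalized (F : POVM α H) : Prop := F Set.univ = 1

/-- `F` is commutative if any two of its values commute. -/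
def IsCommutative (F : POVM α H) : Prop :=
  ∀ Δ₁ Δ₂ : Set α, MeasurableSet Δ₁ → MeasurableSet Δ₂ → Commute (F Δ₁) (F Δ₂)

/-- `F` is orthogonal if its values on disjoint sets have product `0`. -/
def IsOrthogonal (F : POVM α H) : Prop :=
  ∀ Δ₁ Δ₂ : Set α, MeasurableSet Δ₁ → MeasurableSet Δ₂ → Disjoint Δ₁ Δ₂ → F Δ₁ * F Δ₂ = 0

/-- A projection valued measure is an orthogonal, normalized POVM. -/
def IsPVM (F : POVM α H) : Prop := F.IsOrthogonal ∧ F.IsNormalized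

theorem inner_empty (F : POVM α H) (x y : H) : inner ℂ (F ∅ x) y = 0 := by
  have h := F.hasSum_iUnion (fun _ => ∅) (fun _ => MeasurableSet.empty)
    (fun _ _ _ => disjoint_bot_left) x y
  exact tendsto_nhds_unique tendsto_const_nhds h.summable.tendsto_atTop_zero

/-- The finite measure `Δ ↦ ⟨F(Δ) x, x⟩`. -/
def scalarMeasure (F : POVM α H) (x : H) : Measure α :=
  Measure.ofMeasurable (fun Δ _ => ENNReal.ofReal (RCLike.re (inner ℂ (F Δ x) x)))
    (by simp [F.inner_empty])
    (by
      intro Δ hΔ hd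
      have h := RCLike.reCLM.hasSum (F.hasSum_iUnion Δ hΔ hd x x)
      have h' : HasSum (fun n => RCLike.re (inner ℂ (F (Δ n) x) x))
          (RCLike.re (inner ℂ (F (⋃ n, Δ n) x) x)) := h
      rw [← h'.tsum_eq]
      exact ENNReal.ofReal_tsum_of_nonneg
        (fun n => (F.isPositive (Δ n) (hΔ n)).re_inner_nonneg_left x) h'.summable)

theorem scalarMeasure_apply (F : POVM α H) (x : H) {Δ : Set α} (hΔ : MeasurableSet Δ) :
    F.scalarMeasure x Δ = ENNReal.ofReal (RCLike.re (inner ℂ (F Δ x) x)) :=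
  Measure.ofMeasurable_apply Δ hΔ

/-- `B = ∫_Γ f dF`, i.e. `⟨B x, x⟩ = ∫_Γ f(l) d⟨F(l) x, x⟩` for every vector `x`, where the
scalar integrals exist. -/
def HasIntegral (F : POVM α H) (Γ : Set α) (f : α → ℝ) (B : H →L[ℂ] H) : Prop :=
  ∀ x : H, IntegrableOn f Γ (F.scalarMeasure x) ∧
    inner ℂ (B x) x = ((∫ l in Γ, f l ∂(F.scalarMeasure x) : ℝ) : ℂ)

end POVM

/-- The ring of sets generated by the open intervals of `ℝ` with rational end-points. -/
def rationalRing : Set (Set ℝ) :=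
  ⋂₀ {C | IsSetRing C ∧ ∀ a b : ℚ, Set.Ioo (a : ℝ) (b : ℝ) ∈ C}

section Kernels

/- A map `Λ × 𝓑(ℝ) → [0,1]`, `(l, Δ) ↦ μ_Δ(l)`, is written `μ : Set ℝ → Λ → ℝ` with values
`μ Δ l`; only Borel sets `Δ` matter. -/

variable {Λ : Type*} [MeasurableSpace Λ]

/-- `μ` is a Markov kernel: each `μ_Δ` is measurable and each `μ_(·)(l)` is a probability
measure on `ℝ`, i.e. `μ` is given by a Markov kernel in the sense of Mathlib. -/
def IsMarkovMap (μ : Set ℝ → Λ → ℝ) : Prop :=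
  ∃ κ : Kernel Λ ℝ, IsMarkovKernel κ ∧
    ∀ Δ : Set ℝ, MeasurableSet Δ → ∀ l : Λ, μ Δ l = (κ l).real Δ

/-- `μ` is a Feller Markov kernel: a Markov kernel which maps bounded continuous functions to
bounded continuous functions. -/
def IsFellerMarkovMap [TopologicalSpace Λ] (μ : Set ℝ → Λ → ℝ) : Prop :=
  ∃ κ : Kernel Λ ℝ, IsMarkovKernel κ ∧
    (∀ Δ : Set ℝ, MeasurableSet Δ → ∀ l : Λ, μ Δ l = (κ l).real Δ) ∧
    ∀ f : BoundedContinuousFunction ℝ ℝ,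
      Continuous (fun l => ∫ t, f t ∂(κ l)) ∧ ∃ C : ℝ, ∀ l, |∫ t, f t ∂(κ l)| ≤ C

/-- `μ : Λ × 𝓑(ℝ) → [0,1]` is a weak Markov kernel with respect to the measure `ν`. -/
structure IsWeakMarkovMap (ν : Measure Λ) (μ : Set ℝ → Λ → ℝ) : Prop where
  mem_Icc : ∀ Δ : Set ℝ, MeasurableSet Δ → ∀ l : Λ, μ Δ l ∈ Set.Icc (0 : ℝ) 1
  measurable : ∀ Δ : Set ℝ, MeasurableSet Δ → Measurable (μ Δ)
  univ_ae : ∀ᵐ l ∂ν, μ Set.univ l = 1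
  empty_ae : ∀ᵐ l ∂ν, μ ∅ l = 0
  hasSum_ae : ∀ Δ : ℕ → Set ℝ, (∀ n, MeasurableSet (Δ n)) →
    Pairwise (fun i j => Disjoint (Δ i) (Δ j)) →
    ∀ᵐ l ∂ν, HasSum (fun n => μ (Δ n) l) (μ (⋃ n, Δ n) l)

variable {H : Type*} [NormedAddCommGroup H] [InnerProductSpace ℂ H] [CompleteSpace H]

/-- `(μ, E, Γ ⊂ Λ)` is a strong Markov kernel with respect to the PVM `E`: it is a weak Markov
kernel with respect to all the measures `⟨E(·) x, x⟩`, the Borel set `Γ` satisfies `E(Γ) = 1`,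
and the restriction of `μ` to `Γ` is a Markov kernel. -/
structure IsStrongMarkovMap (μ : Set ℝ → Λ → ℝ) (E : POVM Λ H) (Γ : Set Λ) : Prop where
  isPVM : E.IsPVM
  weak : ∀ x : H, IsWeakMarkovMap (E.scalarMeasure x) μ
  measurableSet : MeasurableSet Γ
  apply_eq_one : E Γ = 1
  markov : IsMarkovMap (fun Δ (l : Γ) => μ Δ l)

/-- The family `{μ_Δ}`, `Δ` Borel, separates the points of `Γ`. -/
def SeparatesPointsOn (μ : Set ℝ → Λ → ℝ) (Γ : Set Λ) : Prop :=
  ∀ l ∈ Γ, ∀ l' ∈ Γ, l ≠ l' → ∃ Δ : Set ℝ, MeasurableSet Δ ∧ μ Δ l ≠ μ Δ l'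

/-- `A = ∫ l dE(l)` is a bounded self-adjoint operator with spectrum in `[0,1]`, and
`(μ, E, Γ ⊂ σ(A))` is a strong Markov kernel with the properties (1) continuity of `μ_Δ` on
`σ(A)` for `Δ` in the ring generated by the rational open intervals, (2) `F(Δ) = ∫_Γ μ_Δ dE` for
all Borel `Δ`, (3) separation of the points of `Γ`. -/
structure IsSharpRepresentation (F : POVM ℝ H) (A : H →L[ℂ] H) (E : POVM (spectrum ℝ A) H)
    (μ : Set ℝ → spectrum ℝ A → ℝ) (Γ : Set (spectrum ℝ A)) : Prop where
  isSelfAdjoint : IsSelfAdjoint A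
  spectrum_subset : spectrum ℝ A ⊆ Set.Icc 0 1
  eq_integral : E.HasIntegral Set.univ (fun l => (l : ℝ)) A
  strong : IsStrongMarkovMap μ E Γ
  continuous : ∀ Δ ∈ rationalRing, Continuous (μ Δ)
  smearing : ∀ Δ : Set ℝ, MeasurableSet Δ → E.HasIntegral Γ (μ Δ) (F Δ)
  separates : SeparatesPointsOn μ Γ

end Kernels

end

/-
A sharp representation forces `F` to commute because an operator `∫ f dE` lies in the bicommutant
of the commutative PVM `E`; it is Feller because weak convergence of probability measures is
tested by the open intervals with rational end-points.

For the existence of a sharp representation, restrict a commutative `F` to a countable algebra of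
Borel sets `Δ`. The spectral projections `p_k` of the operators `F(Δ)` for the half-lines `[q, ∞)`,
`q` rational, form a commuting sequence, and the Cantor sum `A = ∑ (1/3)^(k+1) p_k` separates the
characters of the C⋆-algebra which they generate. Hence `F(Δ) = f_Δ(A)` with `f_Δ` continuous on
the spectrum of `A`, and the `f_Δ` separate the points outside a null set, where their level sets
determine the `p_k`. Almost everywhere, `q ↦ f_Δ(l)`, `Δ = (-∞, q]`, is the restriction to `ℚ` of
the distribution function of a probability measure `κ(l)`; then `F(Δ) = ∫ κ(l)(Δ) dE(l)` for every
Borel set `Δ`, and the kernel `κ` may be replaced by the continuous functions `f_Δ` on the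
countable algebra because both agree almost everywhere.
-/

noncomputable section

open Filter Topology
open scoped NNReal ENNReal

theorem clm_ext_inner_self {H : Type*} [NormedAddCommGroup H] [InnerProductSpace ℂ H]
    {S T : H →L[ℂ] H} (h : ∀ x, inner ℂ (S x) x = inner ℂ (T x) x) : S = T :=
  ContinuousLinearMap.coe_injective <| (ext_inner_map (S : H →ₗ[ℂ] H) (T : H →ₗ[ℂ] H)).1 h

namespace POVM

variable {α : Type*} [MeasurableSpace α] {H : Type*} [NormedAddCommGroup H]
  [InnerProductSpace ℂ H] [CompleteSpace H] {E F : POVM α H} {S T : Set α}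

instance isFiniteMeasure_scalarMeasure (F : POVM α H) (x : H) :
    IsFiniteMeasure (F.scalarMeasure x) :=
  ⟨by rw [F.scalarMeasure_apply x MeasurableSet.univ]; exact ENNReal.ofReal_lt_top⟩

theorem scalarMeasure_real (F : POVM α H) (x : H) (hS : MeasurableSet S) :
    (F.scalarMeasure x).real S = RCLike.re (inner ℂ (F S x) x) := by
  rw [measureReal_def, F.scalarMeasure_apply x hS,
    ENNReal.toReal_ofReal ((F.isPositive S hS).re_inner_nonneg_left x)]

theorem isSelfAdjoint_apply (F : POVM α H) (hS : MeasurableSet S) : IsSelfAdjoint (F S) :=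
  (F.isPositive S hS).isSelfAdjoint

theorem inner_apply_self (F : POVM α H) (x : H) (hS : MeasurableSet S) :
    inner ℂ (F S x) x = (((F.scalarMeasure x).real S : ℝ) : ℂ) := by
  rw [F.scalarMeasure_real x hS]
  exact ((F.isPositive S hS).toLinearMap.isSymmetric.coe_re_inner_apply_self x).symm

theorem apply_union (F : POVM α H) (hS : MeasurableSet S) (hT : MeasurableSet T)
    (hd : Disjoint S T) : F (S ∪ T) = F S + F T :=
  clm_ext_inner_self fun x => by
    rw [add_apply, inner_add_left, F.inner_apply_self x (hS.union hT),
      F.inner_apply_self x hS, F.inner_apply_self x hT, measureReal_union hd hT,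
      Complex.ofReal_add]

theorem apply_sdiff (F : POVM α H) (hS : MeasurableSet S) (hT : MeasurableSet T) (hST : S ⊆ T) :
    F (T \ S) = F T - F S := by
  rw [eq_sub_iff_add_eq', ← F.apply_union hS (hT.diff hS) Set.disjoint_sdiff_right,
    Set.union_sdiff_cancel hST]

theorem apply_inter_add_sdiff (F : POVM α H) (hS : MeasurableSet S) (hT : MeasurableSet T) :
    F (S ∩ T) + F (S \ T) = F S := by
  rw [← F.apply_union (hS.inter hT) (hS.diff hT) Set.disjoint_sdiff_inter.symm,
    Set.inter_union_sdiff]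

theorem IsNormalized.apply_compl (hF : F.IsNormalized) (hS : MeasurableSet S) :
    F Sᶜ = 1 - F S := by
  rw [Set.compl_eq_univ_sdiff, F.apply_sdiff hS .univ S.subset_univ, hF]

theorem IsNormalized.scalarMeasure_univ (hF : F.IsNormalized) (x : H) :
    (F.scalarMeasure x).real Set.univ = ‖x‖ ^ 2 := by
  rw [F.scalarMeasure_real x .univ, hF, one_apply_eq_self, inner_self_eq_norm_sq]

theorem IsPVM.apply_inter (hE : E.IsPVM) (hS : MeasurableSet S) (hT : MeasurableSet T) :
    E (S ∩ T) = E S * E T := by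
  have mul_apply_inter : ∀ {R : Set α}, MeasurableSet R → R ⊆ S → E S * E R = E R := by
    intro R hR hRS
    have h := hE.1 Sᶜ R hS.compl hR (Set.disjoint_compl_left_iff_subset.2 hRS)
    rwa [hE.2.apply_compl hS, sub_mul, one_mul, sub_eq_zero, eq_comm] at h
  rw [← E.apply_inter_add_sdiff hT hS, mul_add, Set.inter_comm T S,
    mul_apply_inter (hS.inter hT) Set.inter_subset_left,
    hE.1 S (T \ S) hS (hT.diff hS) Set.disjoint_sdiff_right, add_zero]

theorem IsPVM.apply_mul_self (hE : E.IsPVM) (hS : MeasurableSet S) : E S * E S = E S := by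
  rw [← hE.apply_inter hS hS, Set.inter_self]

theorem IsPVM.isCommutative (hE : E.IsPVM) : E.IsCommutative := fun S T hS hT => by
  rw [Commute, SemiconjBy, ← hE.apply_inter hS hT, ← hE.apply_inter hT hS, Set.inter_comm]

theorem IsPVM.scalarMeasure_apply_vector (hE : E.IsPVM) (hS : MeasurableSet S) (x : H) :
    E.scalarMeasure (E S x) = (E.scalarMeasure x).restrict S := by
  ext T hT
  have hST : E T * E S = E S * E (T ∩ S) := by
    rw [← hE.apply_inter hT hS, ← hE.apply_inter hS (hT.inter hS),
      Set.inter_eq_right.2 Set.inter_subset_right]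
  have key : inner ℂ (E T (E S x)) (E S x) = inner ℂ (E (T ∩ S) x) x := by
    rw [← ContinuousLinearMap.adjoint_inner_left, (E.isSelfAdjoint_apply hS).adjoint_eq,
      ← mul_apply_eq_comp, ← mul_apply_eq_comp, mul_assoc, hST, ← mul_assoc,
      hE.apply_mul_self hS, ← hST, hE.apply_inter hT hS]
  rw [Measure.restrict_apply hT, E.scalarMeasure_apply _ hT,
    E.scalarMeasure_apply x (hT.inter hS), key]

end POVM

namespace POVM

variable {α : Type*} [MeasurableSpace α] {H : Type*} [NormedAddCommGroup H]
  [InnerProductSpace ℂ H] [CompleteSpace H] {E : POVM α H} {f g : α → ℝ} {B C : H →L[ℂ] H}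

theorem HasIntegral.re_inner {Γ : Set α} (h : E.HasIntegral Γ f B) (x : H) :
    RCLike.re (inner ℂ (B x) x) = ∫ l in Γ, f l ∂(E.scalarMeasure x) := by
  rw [(h x).2]
  exact Complex.ofReal_re _

theorem HasIntegral.isSelfAdjoint {Γ : Set α} (h : E.HasIntegral Γ f B) : IsSelfAdjoint B := by
  rw [ContinuousLinearMap.isSelfAdjoint_iff_isSymmetric,
    LinearMap.isSymmetric_iff_inner_map_self_real]
  exact fun x => Complex.conj_eq_iff_real.2 ⟨_, (h x).2⟩

theorem hasIntegral_indicator_iff {Γ : Set α} (hΓ : MeasurableSet Γ) :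
    E.HasIntegral Set.univ (Γ.indicator f) B ↔ E.HasIntegral Γ f B := by
  simp only [HasIntegral, Measure.restrict_univ, IntegrableOn, integral_indicator hΓ,
    integrable_indicator_iff hΓ]

theorem hasIntegral_indicator_one {S : Set α} (hS : MeasurableSet S) :
    E.HasIntegral Set.univ (S.indicator 1) (E S) :=
  (hasIntegral_indicator_iff hS).2 fun x => ⟨integrable_const 1, by
    rw [E.inner_apply_self x hS, ← integral_indicator hS, integral_indicator_one hS]⟩

theorem HasIntegral.sub {Γ : Set α} (hB : E.HasIntegral Γ f B) (hC : E.HasIntegral Γ g C) :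
    E.HasIntegral Γ (fun l => f l - g l) (B - C) := fun x => by
  refine ⟨(hB x).1.sub (hC x).1, ?_⟩
  rw [sub_apply, inner_sub_left, (hB x).2, (hC x).2, integral_sub (hB x).1 (hC x).1,
    Complex.ofReal_sub]

theorem hasIntegral_sum_indicator (E : POVM α H) {ι : Type*} (s : Finset ι) (c : ι → ℝ)
    {S : ι → Set α} (hS : ∀ i, MeasurableSet (S i)) :
    E.HasIntegral Set.univ (fun l => ∑ i ∈ s, (S i).indicator (fun _ => c i) l)
      (∑ i ∈ s, c i • E (S i)) := fun x => by
  have hint : ∀ i ∈ s, Integrable ((S i).indicator fun _ => c i)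
      ((E.scalarMeasure x).restrict Set.univ) :=
    fun i _ => (integrable_const (c i)).indicator (hS i)
  refine ⟨integrable_finsetSum _ hint, ?_⟩
  rw [integral_finsetSum _ hint, sum_apply, sum_inner, Complex.ofReal_sum]
  refine Finset.sum_congr rfl fun i _ => ?_
  rw [smul_apply, inner_smul_left_eq_smul, E.inner_apply_self x (hS i), Measure.restrict_univ,
    integral_indicator_const _ (hS i), smul_eq_mul, mul_comm, Complex.ofReal_mul,
    Complex.real_smul, mul_comm]

theorem HasIntegral.norm_le (hE : E.IsNormalized) (h : E.HasIntegral Set.univ f B) {c : ℝ}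
    (hc : 0 ≤ c) (hf : ∀ l, |f l| ≤ c) : ‖B‖ ≤ c := by
  rw [ContinuousLinearMap.norm_eq_iSup_rayleighQuotient B
    (ContinuousLinearMap.isSelfAdjoint_iff_isSymmetric.1 h.isSelfAdjoint)]
  refine Real.iSup_le (fun x => ?_) hc
  rw [ContinuousLinearMap.rayleighQuotient, abs_div, abs_of_nonneg (sq_nonneg ‖x‖)]
  refine div_le_of_le_mul₀ (sq_nonneg _) hc ?_
  rw [ContinuousLinearMap.reApplyInnerSelf, h.re_inner x, ← hE.scalarMeasure_univ x,
    Measure.restrict_univ]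
  exact norm_integral_le_of_norm_le_const
    (ae_of_all _ fun l => (Real.norm_eq_abs _).trans_le (hf l))

theorem HasIntegral.ae_eq (hE : E.IsPVM) (hf : E.HasIntegral Set.univ f B)
    (hg : E.HasIntegral Set.univ g B) (x : H) : f =ᵐ[E.scalarMeasure x] g := by
  have hf' := fun x => (hf x).1
  have hg' := fun x => (hg x).1
  simp only [integrableOn_univ] at hf' hg'
  refine (hf' x).ae_eq_of_forall_setIntegral_eq _ _ (hg' x) fun S hS _ => ?_
  have h := (hf.re_inner (E S x)).symm.trans (hg.re_inner (E S x))
  rwa [Measure.restrict_univ, hE.scalarMeasure_apply_vector hS] at h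

end POVM

theorem abs_sub_floor_mul_div_le {N : ℕ} (hN : 0 < N) (t : ℝ) :
    |t - ⌊N * t⌋ / N| ≤ (N : ℝ)⁻¹ := by
  have hN' : (0 : ℝ) < N := by exact_mod_cast hN
  rw [sub_div' hN'.ne', abs_div, abs_of_pos hN', mul_comm t, ← Int.fract,
    abs_of_nonneg (Int.fract_nonneg _), inv_eq_one_div]
  gcongr
  exact (Int.fract_lt_one _).le

theorem sum_indicator_Ico_eq_floor_div {N M : ℕ} (hN : 0 < N) {t : ℝ} (ht : |t| ≤ M) :
    ∑ j ∈ Finset.Icc (-(N * M : ℤ)) (N * M),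
      (Set.Ico (j / N : ℝ) ((j + 1) / N : ℝ)).indicator (fun _ => (j / N : ℝ)) t =
      ⌊N * t⌋ / N := by
  have hN' : (0 : ℝ) < N := by exact_mod_cast hN
  have hmem : ∀ j : ℤ, t ∈ Set.Ico (j / N : ℝ) ((j + 1) / N : ℝ) ↔ ⌊N * t⌋ = j := by
    intro j
    rw [Int.floor_eq_iff, Set.mem_Ico, div_le_iff₀ hN', lt_div_iff₀ hN', mul_comm t]
  have hfloor : ⌊N * t⌋ ∈ Finset.Icc (-(N * M : ℤ)) (N * M) := by
    obtain ⟨h1, h2⟩ := abs_le.1 ht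
    rw [Finset.mem_Icc, Int.le_floor]
    refine ⟨by push_cast; nlinarith, Int.floor_le_iff.2 ?_⟩
    push_cast
    nlinarith
  simp only [Set.indicator_apply, hmem, Finset.sum_ite_eq, hfloor, if_true]

namespace POVM

variable {α : Type*} [MeasurableSpace α] {H : Type*} [NormedAddCommGroup H]
  [InnerProductSpace ℂ H] [CompleteSpace H] {E : POVM α H} {f : α → ℝ} {B : H →L[ℂ] H}

/-- Approximate `f` uniformly by `⌊N f⌋ / N`. -/
theorem HasIntegral.mem_topologicalClosure_span (hE : E.IsNormalized) (hf : Measurable f) {c : ℝ}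
    (hc : ∀ l, |f l| ≤ c) (hB : E.HasIntegral Set.univ f B) :
    B ∈ (Submodule.span ℝ
      (Set.range fun q : ℚ => E (f ⁻¹' Set.Ici (q : ℝ)))).topologicalClosure := by
  refine Metric.mem_closure_iff.2 fun ε hε => ?_
  obtain ⟨N, hN, hNε⟩ := Real.exists_nat_pos_inv_lt hε
  obtain ⟨M, hM⟩ := exists_nat_ge c
  let J : Finset ℤ := Finset.Icc (-(N * M : ℤ)) (N * M)
  let S : ℤ → Set α := fun j => f ⁻¹' Set.Ico (j / N : ℝ) ((j + 1) / N : ℝ)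
  have hS : ∀ j, MeasurableSet (S j) := fun j => hf measurableSet_Ico
  have E_S : ∀ j, E (S j) =
      E (f ⁻¹' Set.Ici (j / N : ℝ)) - E (f ⁻¹' Set.Ici ((j + 1) / N : ℝ)) := fun j => by
    rw [← E.apply_sdiff (hf measurableSet_Ici) (hf measurableSet_Ici), ← Set.preimage_sdiff,
      Set.Ici_sdiff_Ici]
    refine Set.preimage_mono (Set.Ici_subset_Ici.2 ?_)
    gcongr
    linarith
  have E_mem : ∀ j : ℤ, E (f ⁻¹' Set.Ici (j / N : ℝ)) ∈ Submodule.span ℝ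
      (Set.range fun q : ℚ => E (f ⁻¹' Set.Ici (q : ℝ))) := fun j =>
    Submodule.subset_span ⟨j / N, by simp only [Rat.cast_div, Rat.cast_intCast, Rat.cast_natCast]⟩
  refine ⟨∑ j ∈ J, (j / N : ℝ) • E (S j), Submodule.sum_mem _ fun j _ =>
    Submodule.smul_mem _ _ ?_, ?_⟩
  · rw [E_S]
    exact Submodule.sub_mem _ (E_mem j) (by exact_mod_cast E_mem (j + 1))
  · rw [dist_eq_norm]
    refine ((hB.sub (E.hasIntegral_sum_indicator J _ hS)).norm_le hE (by positivity)
      fun l => ?_).trans_lt hNε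
    have hfloor := sum_indicator_Ico_eq_floor_div hN ((hc l).trans hM)
    exact (congrArg (fun s => |f l - s|) hfloor).trans_le (abs_sub_floor_mul_div_le hN (f l))

theorem HasIntegral.commute (hE : E.IsNormalized) (hf : Measurable f) {c : ℝ}
    (hc : ∀ l, |f l| ≤ c) (hB : E.HasIntegral Set.univ f B) {C : H →L[ℂ] H}
    (hC : ∀ S, MeasurableSet S → Commute (E S) C) : Commute B C := by
  let K : Submodule ℝ (H →L[ℂ] H) := (Subalgebra.centralizer ℝ {C}).toSubmodule
  have hK : IsClosed (K : Set (H →L[ℂ] H)) := Set.isClosed_centralizer {C}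
  have hspan := Submodule.topologicalClosure_minimal _ (Submodule.span_le.2 ?_) hK
    (hB.mem_topologicalClosure_span hE hf hc)
  · exact (hspan C rfl).symm
  · rintro _ ⟨q, rfl⟩ _ rfl
    exact (hC _ (hf measurableSet_Ici)).symm

end POVM

namespace IsSharpRepresentation

variable {H : Type*} [NormedAddCommGroup H] [InnerProductSpace ℂ H] [CompleteSpace H]
  {F : POVM ℝ H} {A : H →L[ℂ] H} {E : POVM (spectrum ℝ A) H} {μ : Set ℝ → spectrum ℝ A → ℝ}
  {Γ : Set (spectrum ℝ A)}

theorem commute (h : IsSharpRepresentation F A E μ Γ) {Δ : Set ℝ} (hΔ : MeasurableSet Δ)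
    {C : H →L[ℂ] H} (hC : ∀ S, MeasurableSet S → Commute (E S) C) : Commute (F Δ) C := by
  have hw := h.strong.weak 0
  refine (POVM.hasIntegral_indicator_iff h.strong.measurableSet).2 (h.smearing Δ hΔ) |>.commute
    h.strong.isPVM.2 ((hw.measurable Δ hΔ).indicator h.strong.measurableSet) (c := 1)
    (fun l => (norm_indicator_le_norm_self (μ Δ) l).trans ?_) hC
  obtain ⟨h0, h1⟩ := hw.mem_Icc Δ hΔ l
  exact abs_le.2 ⟨by linarith, h1⟩

theorem isCommutative (h : IsSharpRepresentation F A E μ Γ) : F.IsCommutative :=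
  fun _ _ h₁ h₂ => h.commute h₁ fun S hS => (h.commute h₂ fun T hT =>
    h.strong.isPVM.isCommutative T S hT hS).symm

end IsSharpRepresentation

theorem tendsto_probabilityMeasure_of_tendsto_Ioo_rat {ι : Type*} {l : Filter ι}
    [l.IsCountablyGenerated] {P : ι → ProbabilityMeasure ℝ} {Q : ProbabilityMeasure ℝ}
    (h : ∀ a b : ℚ, Tendsto (fun i => P i (Set.Ioo (a : ℝ) b)) l (𝓝 (Q (Set.Ioo (a : ℝ) b)))) :
    Tendsto P l (𝓝 Q) := by
  refine Real.isPiSystem_Ioo_rat.tendsto_probabilityMeasure_of_tendsto_of_mem ?_ ?_ ?_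
  · intro s hs
    obtain ⟨a, b, -, rfl⟩ := by simpa only [Set.mem_iUnion, Set.mem_singleton_iff] using hs
    exact measurableSet_Ioo
  · intro u hu x hx
    obtain ⟨s, hs, hxs, hsu⟩ := Real.isTopologicalBasis_Ioo_rat.exists_subset_of_mem_open hx hu
    exact ⟨s, hs, (Real.isTopologicalBasis_Ioo_rat.isOpen hs).mem_nhds hxs, hsu⟩
  · intro s hs
    obtain ⟨a, b, -, rfl⟩ := by simpa only [Set.mem_iUnion, Set.mem_singleton_iff] using hs
    exact h a b

theorem IsMarkovMap.isFellerMarkovMap {Λ : Type*} [MeasurableSpace Λ] [TopologicalSpace Λ]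
    [FirstCountableTopology Λ] {μ : Set ℝ → Λ → ℝ} (hμ : IsMarkovMap μ)
    (hc : ∀ a b : ℚ, Continuous (μ (Set.Ioo (a : ℝ) b))) : IsFellerMarkovMap μ := by
  obtain ⟨κ, hκ, hμκ⟩ := hμ
  refine ⟨κ, hκ, hμκ, fun f => ⟨continuous_iff_continuousAt.2 fun l => ?_, ‖f‖, fun l => ?_⟩⟩
  · let P : Λ → ProbabilityMeasure ℝ := fun l => ⟨κ l, inferInstance⟩
    have hP : Tendsto P (𝓝 l) (𝓝 (P l)) :=
      tendsto_probabilityMeasure_of_tendsto_Ioo_rat fun a b => by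
        have h := (hc a b).tendsto l
        rw [funext (hμκ (Set.Ioo (a : ℝ) b) measurableSet_Ioo)] at h
        exact NNReal.tendsto_coe.1 h
    exact ProbabilityMeasure.tendsto_iff_forall_integral_tendsto.1 hP f
  · exact (Real.norm_eq_abs _).symm.trans_le (f.norm_integral_le_norm (κ l))

theorem Ioo_mem_rationalRing (a b : ℚ) : Set.Ioo (a : ℝ) b ∈ rationalRing :=
  Set.mem_sInter.2 fun _ hC => hC.2 a b

theorem IsSharpRepresentation.isFellerMarkovMap {H : Type*} [NormedAddCommGroup H]
    [InnerProductSpace ℂ H] [CompleteSpace H] {F : POVM ℝ H} {A : H →L[ℂ] H}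
    {E : POVM (spectrum ℝ A) H} {μ : Set ℝ → spectrum ℝ A → ℝ} {Γ : Set (spectrum ℝ A)}
    (h : IsSharpRepresentation F A E μ Γ) : IsFellerMarkovMap (fun Δ (l : Γ) => μ Δ l) :=
  h.strong.markov.isFellerMarkovMap fun a b =>
    (h.continuous _ (Ioo_mem_rationalRing a b)).comp continuous_subtype_val

section WeakLimits

variable {H : Type*} [NormedAddCommGroup H] [InnerProductSpace ℂ H]

theorem tendsto_inner_of_tendsto_inner_self {ι : Type*} {l : Filter ι} {T : ι → H →L[ℂ] H}
    {q : H → ℂ} (hq : ∀ x, Tendsto (fun n => inner ℂ (T n x) x) l (𝓝 (q x))) (x y : H) :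
    Tendsto (fun n => inner ℂ (T n x) y) l (𝓝 ((q (x + y) - q (x - y) -
      Complex.I * q (x + Complex.I • y) + Complex.I * q (x - Complex.I • y)) / 4)) := by
  simp_rw [show ∀ n, inner ℂ (T n x) y = _ from
    fun n => inner_map_polarization' (T n : H →ₗ[ℂ] H) x y]
  exact ((((hq _).sub (hq _)).sub ((hq _).const_mul _)).add ((hq _).const_mul _)).div_const _

theorem hasSum_inner_of_hasSum_inner_self {ι : Type*} {T : ι → H →L[ℂ] H} {S : H →L[ℂ] H}
    (h : ∀ x, HasSum (fun n => inner ℂ (T n x) x) (inner ℂ (S x) x)) (x y : H) :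
    HasSum (fun n => inner ℂ (T n x) y) (inner ℂ (S x) y) := by
  simp_rw [show ∀ R : H →L[ℂ] H, inner ℂ (R x) y = _ from
    fun R => inner_map_polarization' (R : H →ₗ[ℂ] H) x y]
  exact ((((h _).sub (h _)).sub ((h _).mul_left _)).add ((h _).mul_left _)).div_const _

variable [CompleteSpace H] {T : ℕ → H →L[ℂ] H}

theorem exists_norm_le_of_tendsto_inner {b : H → H → ℂ}
    (hb : ∀ x y, Tendsto (fun n => inner ℂ (T n x) y) atTop (𝓝 (b x y))) :
    ∃ C, ∀ n, ‖T n‖ ≤ C := by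
  refine banach_steinhaus fun x => ?_
  obtain ⟨C, hC⟩ := banach_steinhaus (g := fun n => innerSL ℂ (T n x)) fun y => by
    obtain ⟨C, hC⟩ := (hb x y).norm.bddAbove_range
    exact ⟨C, fun n => hC ⟨n, rfl⟩⟩
  exact ⟨C, fun n => (innerSL_apply_norm ℂ (T n x)).symm.trans_le (hC n)⟩

theorem exists_tendsto_inner_of_tendsto_inner_self {q : H → ℂ}
    (hq : ∀ x, Tendsto (fun n => inner ℂ (T n x) x) atTop (𝓝 (q x))) :
    ∃ S : H →L[ℂ] H, ∀ x y, Tendsto (fun n => inner ℂ (T n x) y) atTop (𝓝 (inner ℂ (S x) y)) := by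
  have hlim : ∀ x y, ∃ l, Tendsto (fun n => inner ℂ (T n x) y) atTop (𝓝 l) := fun x y =>
    ⟨_, tendsto_inner_of_tendsto_inner_self hq x y⟩
  choose b hb using hlim
  obtain ⟨C, hC⟩ := exists_norm_le_of_tendsto_inner hb
  let B : H →ₗ⋆[ℂ] H →ₗ[ℂ] ℂ := LinearMap.mk₂'ₛₗ (starRingEnd ℂ) (RingHom.id ℂ) b
    (fun x x' y => tendsto_nhds_unique (hb (x + x') y)
      (((hb x y).add (hb x' y)).congr fun n => by rw [map_add, inner_add_left]))
    (fun c x y => tendsto_nhds_unique (hb (c • x) y)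
      (((hb x y).const_mul (starRingEnd ℂ c)).congr fun n => by rw [map_smul, inner_smul_left]))
    (fun x y y' => tendsto_nhds_unique (hb x (y + y'))
      (((hb x y).add (hb x y')).congr fun n => (inner_add_right _ _ _).symm))
    (fun c x y => tendsto_nhds_unique (hb x (c • y))
      (((hb x y).const_mul c).congr fun n => (inner_smul_right _ _ _).symm))
  have hB : ∀ x y, ‖B x y‖ ≤ C * ‖x‖ * ‖y‖ := fun x y => by
    refine le_of_tendsto (hb x y).norm (.of_forall fun n => (norm_inner_le_norm _ _).trans ?_)
    gcongr
    exact (T n).le_of_opNorm_le (hC n) x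
  refine ⟨InnerProductSpace.continuousLinearMapOfBilin (B.mkContinuous₂ C hB), fun x y => ?_⟩
  rw [InnerProductSpace.continuousLinearMapOfBilin_apply]
  exact hb x y

theorem commute_of_tendsto_inner {S R : H →L[ℂ] H}
    (h : ∀ x y, Tendsto (fun n => inner ℂ (T n x) y) atTop (𝓝 (inner ℂ (S x) y)))
    (hR : ∀ n, Commute R (T n)) : Commute R S := by
  ext x
  refine ext_inner_right ℂ fun y => ?_
  rw [mul_apply_eq_comp, mul_apply_eq_comp, ← ContinuousLinearMap.adjoint_inner_right]
  refine tendsto_nhds_unique (h x _) ((h (R x) y).congr fun n => ?_)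
  rw [ContinuousLinearMap.adjoint_inner_right, ← mul_apply_eq_comp, ← mul_apply_eq_comp, (hR n).eq]

end WeakLimits

section Measures

variable {α : Type*} [MeasurableSpace α]

theorem hasSum_measureReal_iUnion (μ : Measure α) [IsFiniteMeasure μ] {S : ℕ → Set α}
    (hS : ∀ n, MeasurableSet (S n)) (hd : Pairwise (Function.onFun Disjoint S)) :
    HasSum (fun n => μ.real (S n)) (μ.real (⋃ n, S n)) := by
  simp only [measureReal_def]
  rw [measure_iUnion hd hS, ENNReal.tsum_toReal_eq fun n => measure_ne_top _ _]
  exact ENNReal.hasSum_toReal (by rw [← measure_iUnion hd hS]; exact measure_ne_top _ _)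

theorem measure_ext_of_forall_integral_nonneg_eq [TopologicalSpace α] [BorelSpace α]
    [HasOuterApproxClosed α] {μ ν : Measure α} [IsFiniteMeasure μ] [IsFiniteMeasure ν]
    (h : ∀ f : C(α, ℝ), 0 ≤ f → ∫ a, f a ∂μ = ∫ a, f a ∂ν) : μ = ν := by
  refine ext_of_forall_lintegral_eq_of_IsFiniteMeasure fun f => ?_
  rw [← ENNReal.toReal_eq_toReal_iff' (f.lintegral_lt_top_of_nnreal μ).ne
    (f.lintegral_lt_top_of_nnreal ν).ne, f.toReal_lintegral_coe_eq_integral,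
    f.toReal_lintegral_coe_eq_integral]
  exact h ⟨fun a => f a, by fun_prop⟩ fun a => (f a).coe_nonneg

end Measures

section SpectralTheorem

theorem integrable_continuousMap {K : Type*} [TopologicalSpace K] [CompactSpace K]
    [MeasurableSpace K] [BorelSpace K] (μ : Measure K) [IsFiniteMeasure μ] (f : C(K, ℝ)) :
    Integrable f μ :=
  f.continuous.integrable_of_hasCompactSupport (HasCompactSupport.of_compactSpace _)

variable {K : Type*} [TopologicalSpace K]
  {H : Type*} [NormedAddCommGroup H] [InnerProductSpace ℂ H] [CompleteSpace H]
  (π : C(K, ℝ) →⋆ₐ[ℝ] (H →L[ℂ] H))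

theorem isSelfAdjoint_apply_continuousMap (f : C(K, ℝ)) : IsSelfAdjoint (π f) :=
  (IsSelfAdjoint.all f).map π

theorem inner_apply_continuousMap_self (f : C(K, ℝ)) (x : H) :
    inner ℂ (π f x) x = ((RCLike.re (inner ℂ (π f x) x) : ℝ) : ℂ) :=
  ((ContinuousLinearMap.isSelfAdjoint_iff_isSymmetric.1
    (isSelfAdjoint_apply_continuousMap π f)).coe_re_inner_apply_self x).symm

variable [CompactSpace K]

/-- The positive functional `f ↦ ⟨π(f) x, x⟩`. -/
def spectralFunctional (x : H) : CompactlySupportedContinuousMap K ℝ →ₚ[ℝ] ℝ where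
  toFun f := RCLike.re (inner ℂ (π f.toContinuousMap x) x)
  map_add' f g := by
    have h : (f + g).toContinuousMap = f.toContinuousMap + g.toContinuousMap := rfl
    rw [h, map_add, add_apply, inner_add_left, map_add]
  map_smul' c f := by
    have h : (c • f).toContinuousMap = c • f.toContinuousMap := rfl
    rw [h, map_smul, smul_apply, inner_smul_left_eq_smul, RCLike.smul_re]
    rfl
  monotone' f g hfg := by
    have h : π f.toContinuousMap ≤ π g.toContinuousMap := OrderHomClass.mono π hfg
    rw [ContinuousLinearMap.le_def] at h
    have := h.re_inner_nonneg_left x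
    rw [sub_apply, inner_sub_left, map_sub] at this
    exact sub_nonneg.1 this

variable [T2Space K] [MeasurableSpace K] [BorelSpace K]

/-- The spectral measure of the representation `π` at the vector `x`: the measure representing
`f ↦ ⟨π(f) x, x⟩`. -/
def spectralMeasure (x : H) : Measure K :=
  RealRMK.rieszMeasure (spectralFunctional π x)

instance isFiniteMeasure_spectralMeasure (x : H) : IsFiniteMeasure (spectralMeasure π x) := by
  unfold spectralMeasure; infer_instance

theorem integral_spectralMeasure (x : H) (f : C(K, ℝ)) :
    ∫ l, f l ∂(spectralMeasure π x) = RCLike.re (inner ℂ (π f x) x) :=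
  RealRMK.integral_rieszMeasure (spectralFunctional π x)
    ⟨f, HasCompactSupport.of_compactSpace _⟩

theorem spectralMeasure_real_univ (x : H) :
    (spectralMeasure π x).real Set.univ = ‖x‖ ^ 2 := by
  have h := integral_spectralMeasure π x 1
  rw [map_one, one_apply_eq_self, inner_self_eq_norm_sq] at h
  simpa only [ContinuousMap.one_apply, integral_const, smul_eq_mul, mul_one] using h

/-- `T` represents the spectral measures of the set `S`, i.e. `T` is the spectral operator
attached to `S`, and lies in the bicommutant of `π`. -/
structure IsSpectralOperator (S : Set K) (T : H →L[ℂ] H) : Prop where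
  inner_apply_self : ∀ x, inner ℂ (T x) x = (((spectralMeasure π x).real S : ℝ) : ℂ)
  commute : ∀ R, (∀ f, Commute R (π f)) → Commute R T

variable {π}

theorem exists_isSpectralOperator_of_tendsto {T : ℕ → H →L[ℂ] H} {S : Set K}
    (hc : ∀ n R, (∀ f, Commute R (π f)) → Commute R (T n)) {m : ℕ → H → ℝ}
    (hT : ∀ n x, inner ℂ (T n x) x = (m n x : ℂ))
    (hm : ∀ x, Tendsto (fun n => m n x) atTop (𝓝 ((spectralMeasure π x).real S))) :
    ∃ T', IsSpectralOperator π S T' := by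
  have hq : ∀ x, Tendsto (fun n => inner ℂ (T n x) x) atTop
      (𝓝 (((spectralMeasure π x).real S : ℝ) : ℂ)) := fun x => by
    simp_rw [hT]
    exact (Complex.continuous_ofReal.tendsto _).comp (hm x)
  obtain ⟨T', hT'⟩ := exists_tendsto_inner_of_tendsto_inner_self hq
  exact ⟨T', fun x => tendsto_nhds_unique (hT' x x) (hq x), fun R hR =>
    commute_of_tendsto_inner hT' fun n => hc n R hR⟩

theorem IsSpectralOperator.compl {S : Set K} {T : H →L[ℂ] H} (hT : IsSpectralOperator π S T)
    (hS : MeasurableSet S) : IsSpectralOperator π Sᶜ (1 - T) where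
  inner_apply_self x := by
    rw [sub_apply, inner_sub_left, hT.inner_apply_self, one_apply_eq_self,
      inner_self_eq_norm_sq_to_K, measureReal_compl hS, spectralMeasure_real_univ]
    push_cast
    rfl
  commute R hR := (Commute.one_right R).sub_right (hT.commute R hR)

theorem exists_isSpectralOperator_iUnion {S : ℕ → Set K} (hd : Pairwise (Function.onFun Disjoint S))
    (hS : ∀ n, MeasurableSet (S n)) {T : ℕ → H →L[ℂ] H}
    (hT : ∀ n, IsSpectralOperator π (S n) (T n)) : ∃ T', IsSpectralOperator π (⋃ n, S n) T' := by
  refine exists_isSpectralOperator_of_tendsto (T := fun n => ∑ k ∈ Finset.range n, T k)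
    (fun n R hR => Commute.sum_right _ _ _ fun k _ => (hT k).commute R hR)
    (m := fun n x => ∑ k ∈ Finset.range n, (spectralMeasure π x).real (S k))
    (fun n x => ?_) fun x => (hasSum_measureReal_iUnion _ hS hd).tendsto_sum_nat
  rw [sum_apply, sum_inner, Complex.ofReal_sum]
  exact Finset.sum_congr rfl fun k _ => (hT k).inner_apply_self x

variable [HasOuterApproxClosed K] (π)

theorem exists_isSpectralOperator_of_isClosed {S : Set K} (hS : IsClosed S) :
    ∃ T, IsSpectralOperator π S T := by
  let f : ℕ → C(K, ℝ) := fun n => ⟨fun l => (hS.apprSeq n l : ℝ), by fun_prop⟩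
  refine exists_isSpectralOperator_of_tendsto (T := fun n => π (f n))
    (m := fun n x => ∫ l, f n l ∂(spectralMeasure π x)) (fun n R hR => hR (f n))
    (fun n x => ?_) fun x => ?_
  · rw [integral_spectralMeasure]
    exact inner_apply_continuousMap_self π (f n) x
  · exact ((ENNReal.tendsto_toReal (measure_ne_top _ _)).comp
      (HasOuterApproxClosed.tendsto_lintegral_apprSeq hS (spectralMeasure π x))).congr fun n =>
        BoundedContinuousFunction.toReal_lintegral_coe_eq_integral _ _

theorem exists_isSpectralOperator {S : Set K} (hS : MeasurableSet S) :
    ∃ T, IsSpectralOperator π S T := by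
  have hgen : ‹MeasurableSpace K› = MeasurableSpace.generateFrom {s | IsClosed s} := by
    rw [← borel_eq_generateFrom_isClosed, BorelSpace.measurable_eq (α := K)]
  induction S, hS using MeasurableSpace.induction_on_inter hgen isPiSystem_isClosed with
  | empty => exact exists_isSpectralOperator_of_isClosed π isClosed_empty
  | basic S hS => exact exists_isSpectralOperator_of_isClosed π hS
  | compl S hS ih =>
    obtain ⟨T, hT⟩ := ih
    exact ⟨1 - T, hT.compl hS⟩
  | iUnion S hd hS ih =>
    choose T hT using ih
    exact exists_isSpectralOperator_iUnion hd hS hT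

open Classical in
/-- The spectral operator attached to a measurable set; the junk value on other sets is `0`. -/
def spectralOperator (S : Set K) : H →L[ℂ] H :=
  if hS : MeasurableSet S then (exists_isSpectralOperator π hS).choose else 0

theorem isSpectralOperator_spectralOperator {S : Set K} (hS : MeasurableSet S) :
    IsSpectralOperator π S (spectralOperator π S) := by
  rw [spectralOperator, dif_pos hS]
  exact (exists_isSpectralOperator π hS).choose_spec

/-- The spectral resolution of the representation `π`. -/
def spectralPOVM : POVM K H where
  toFun := spectralOperator π
  isPositive S hS := by
    refine (ContinuousLinearMap.isPositive_iff_complex _).2 fun x => ?_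
    rw [(isSpectralOperator_spectralOperator π hS).inner_apply_self]
    exact ⟨rfl, measureReal_nonneg⟩
  hasSum_iUnion S hS hd := by
    refine hasSum_inner_of_hasSum_inner_self fun x => ?_
    simp_rw [(isSpectralOperator_spectralOperator π (hS _)).inner_apply_self,
      (isSpectralOperator_spectralOperator π (.iUnion hS)).inner_apply_self]
    exact Complex.ofRealCLM.hasSum (hasSum_measureReal_iUnion _ hS hd)

theorem isSpectralOperator_spectralPOVM {S : Set K} (hS : MeasurableSet S) :
    IsSpectralOperator π S (spectralPOVM π S) :=
  isSpectralOperator_spectralOperator π hS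

theorem spectralPOVM_scalarMeasure (x : H) :
    (spectralPOVM π).scalarMeasure x = spectralMeasure π x := by
  ext S hS
  rw [POVM.scalarMeasure_apply _ _ hS, (isSpectralOperator_spectralPOVM π hS).inner_apply_self]
  exact ENNReal.ofReal_toReal (measure_ne_top _ _)

theorem spectralPOVM_hasIntegral (f : C(K, ℝ)) :
    (spectralPOVM π).HasIntegral Set.univ f (π f) := fun x => by
  refine ⟨(integrable_continuousMap _ f).integrableOn, ?_⟩
  rw [Measure.restrict_univ, spectralPOVM_scalarMeasure, integral_spectralMeasure]
  exact inner_apply_continuousMap_self π f x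

theorem spectralPOVM_isNormalized : (spectralPOVM π).IsNormalized := by
  refine clm_ext_inner_self fun x => ?_
  rw [(isSpectralOperator_spectralPOVM π .univ).inner_apply_self, spectralMeasure_real_univ,
    one_apply_eq_self, inner_self_eq_norm_sq_to_K]
  exact Complex.ofReal_pow _ _

theorem commute_spectralPOVM (f : C(K, ℝ)) {S : Set K} (hS : MeasurableSet S) :
    Commute (π f) (spectralPOVM π S) :=
  (isSpectralOperator_spectralPOVM π hS).commute _ fun g =>
    show π f * π g = π g * π f by rw [← map_mul, ← map_mul, mul_comm]

theorem eq_spectralMeasure {x : H} {ν : Measure K} [IsFiniteMeasure ν]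
    (h : ∀ f : C(K, ℝ), 0 ≤ f → ∫ l, f l ∂ν = RCLike.re (inner ℂ (π f x) x)) :
    ν = spectralMeasure π x :=
  measure_ext_of_forall_integral_nonneg_eq fun f hf =>
    (h f hf).trans (integral_spectralMeasure π x f).symm

theorem re_inner_spectralPOVM_mul_self {R : H →L[ℂ] H} (hR : IsSelfAdjoint R)
    (hc : ∀ f, Commute R (π f)) {x : H} {ν : Measure K} [IsFiniteMeasure ν]
    (hν : ∀ f : C(K, ℝ), 0 ≤ f → ∫ l, f l ∂ν = RCLike.re (inner ℂ ((π f * (R * R)) x) x))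
    {S : Set K} (hS : MeasurableSet S) :
    RCLike.re (inner ℂ ((spectralPOVM π S * (R * R)) x) x) = ν.real S := by
  have inner_mul_self : ∀ T : H →L[ℂ] H, Commute R T →
      inner ℂ ((T * (R * R)) x) x = inner ℂ (T (R x)) (R x) := fun T hT => by
    rw [← ContinuousLinearMap.adjoint_inner_left, hR.adjoint_eq, ← mul_assoc, ← hT.eq]
    rfl
  have hspec := isSpectralOperator_spectralPOVM π hS
  rw [inner_mul_self _ (hspec.commute R hc), hspec.inner_apply_self,
    ← eq_spectralMeasure π fun f hf => (hν f hf).trans (by rw [inner_mul_self _ (hc f)])]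
  exact Complex.ofReal_re _

theorem setIntegral_spectralMeasure (x : H) {f : C(K, ℝ)} (hf : 0 ≤ f) {S : Set K}
    (hS : MeasurableSet S) : ∫ l in S, f l ∂(spectralMeasure π x) =
      RCLike.re (inner ℂ ((π f * spectralPOVM π S) x) x) := by
  let μ := spectralMeasure π x
  obtain ⟨g, hg⟩ : ∃ g : C(K, ℝ), g * g = f :=
    ⟨⟨fun l => √(f l), by fun_prop⟩, by ext l; exact Real.mul_self_sqrt (hf l)⟩
  have hm : Measurable fun l => ENNReal.ofReal (f l) :=
    ENNReal.measurable_ofReal.comp f.continuous.measurable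
  have hi := integrable_continuousMap μ f
  have := isFiniteMeasure_withDensity_ofReal hi.2
  have hπ : π g * π g = π f := by rw [← map_mul, hg]
  have key := re_inner_spectralPOVM_mul_self π (isSelfAdjoint_apply_continuousMap π g)
    (fun h => show π g * π h = π h * π g by rw [← map_mul, ← map_mul, mul_comm])
    (x := x) (ν := μ.withDensity fun l => ENNReal.ofReal (f l)) (fun h _ => ?_) hS
  · rw [(commute_spectralPOVM π f hS).eq, ← hπ, key, measureReal_def, withDensity_apply _ hS]
    exact integral_eq_lintegral_of_nonneg_ae (ae_of_all _ hf) hi.1.restrict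
  · rw [integral_withDensity_eq_integral_toReal_smul hm
      (ae_of_all _ fun _ => ENNReal.ofReal_lt_top), hπ, ← map_mul, ← integral_spectralMeasure]
    refine integral_congr_ae (ae_of_all _ fun l => ?_)
    have h0 : 0 ≤ f l := hf l
    simp only [ENNReal.toReal_ofReal h0, smul_eq_mul, ContinuousMap.mul_apply, mul_comm]

theorem re_inner_spectralPOVM_mul (x : H) {S T : Set K} (hS : MeasurableSet S)
    (hT : MeasurableSet T) : RCLike.re (inner ℂ ((spectralPOVM π S * spectralPOVM π T) x) x) =
      (spectralMeasure π x).real (S ∩ T) := by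
  have hT0 : 0 ≤ spectralPOVM π T :=
    (ContinuousLinearMap.nonneg_iff_isPositive _).2 ((spectralPOVM π).isPositive T hT)
  have hR := CFC.sqrt_mul_sqrt_self _ hT0
  rw [← measureReal_restrict_apply hS, ← hR]
  refine re_inner_spectralPOVM_mul_self π (IsSelfAdjoint.of_nonneg (CFC.sqrt_nonneg _))
    (fun f => (commute_spectralPOVM π f hT).symm.cfcₙ_nnreal _) (fun f hf => ?_) hS
  rw [hR, setIntegral_spectralMeasure π x hf hT]

theorem spectralPOVM_isPVM : (spectralPOVM π).IsPVM := by
  refine ⟨fun S T hS hT hd => ?_, spectralPOVM_isNormalized π⟩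
  have hc : Commute (spectralPOVM π S) (spectralPOVM π T) :=
    (isSpectralOperator_spectralPOVM π hT).commute _ fun f => (commute_spectralPOVM π f hS).symm
  have hsa := ((spectralPOVM π).isSelfAdjoint_apply hS).commute_iff
    ((spectralPOVM π).isSelfAdjoint_apply hT) |>.1 hc
  refine clm_ext_inner_self fun x => ?_
  have h := (ContinuousLinearMap.isSelfAdjoint_iff_isSymmetric.1 hsa).coe_re_inner_apply_self x
  rw [zero_apply, inner_zero_left]
  refine h.symm.trans (Complex.ofReal_eq_zero.2 ?_)
  exact (re_inner_spectralPOVM_mul π x hS hT).trans (by rw [hd.inter_eq, measureReal_empty])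

theorem spectralPOVM_comp {L : Type*} [TopologicalSpace L] [CompactSpace L] [T2Space L]
    [MeasurableSpace L] [BorelSpace L] [HasOuterApproxClosed L]
    {ρ : C(L, ℝ) →⋆ₐ[ℝ] (H →L[ℂ] H)} (θ : C(K, L)) (h : ∀ f, ρ f = π (f.comp θ)) {S : Set L}
    (hS : MeasurableSet S) : spectralPOVM ρ S = spectralPOVM π (θ ⁻¹' S) := by
  have hmap : ∀ x, (spectralMeasure π x).map θ = spectralMeasure ρ x := fun x =>
    eq_spectralMeasure ρ fun f _ => by
      rw [integral_map θ.continuous.aemeasurable f.continuous.aestronglyMeasurable, h,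
        ← integral_spectralMeasure]
      rfl
  refine clm_ext_inner_self fun x => ?_
  rw [(isSpectralOperator_spectralPOVM ρ hS).inner_apply_self, ← hmap,
    map_measureReal_apply θ.continuous.measurable hS,
    (isSpectralOperator_spectralPOVM π (θ.continuous.measurable hS)).inner_apply_self]

end SpectralTheorem

section Generator

open WeakDual Cardinal

theorem exists_comp_eq_of_factorsThrough {X Y : Type*} [TopologicalSpace X]
    [CompactSpace X] [TopologicalSpace Y] [T2Space Y] [NormalSpace Y] {f : C(X, Y)} {h : C(X, ℝ)}
    (hf : Function.FactorsThrough h f) : ∃ g : C(Y, ℝ), g.comp f = h := by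
  let r : C(X, Set.range f) := ⟨Set.rangeFactorization f, by fun_prop⟩
  have hr : IsQuotientMap r :=
    r.continuous.isClosedMap.isQuotientMap r.continuous Set.rangeFactorization_surjective
  have hfr : Function.FactorsThrough h r := fun x y hxy => hf (congrArg Subtype.val hxy)
  obtain ⟨g, hg⟩ := (hr.lift h hfr).exists_restrict_eq (isCompact_range f.continuous).isClosed
  refine ⟨g, ContinuousMap.ext fun x => ?_⟩
  exact (DFunLike.congr_fun hg (r x)).trans (DFunLike.congr_fun (hr.lift_comp h hfr) x)

variable {𝒜 : Type*} [CommCStarAlgebra 𝒜]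

theorem character_eq_ofReal_re (φ : characterSpace ℂ 𝒜) {a : 𝒜} (ha : IsSelfAdjoint a) :
    φ a = ((φ a).re : ℂ) :=
  (Complex.conj_eq_iff_re.1 (ha.map φ)).symm

theorem character_cfc (φ : characterSpace ℂ 𝒜) {a : 𝒜} (ha : IsSelfAdjoint a) {g : ℝ → ℝ}
    (hg : Continuous g) : φ (cfc g a) = (g (φ a).re : ℂ) := by
  rw [StarAlgHomClass.map_cfc (S := ℂ) φ g a hg.continuousOn (map_continuous φ) ha (ha.map φ),
    character_eq_ofReal_re φ ha]
  exact cfc_algebraMap _ _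

theorem exists_cfc_eq_of_forall_character {a b : 𝒜} (ha : IsSelfAdjoint a) (hb : IsSelfAdjoint b)
    (h : ∀ φ ψ : characterSpace ℂ 𝒜, φ a = ψ a → φ b = ψ b) : ∃ g : C(ℝ, ℝ), cfc g a = b := by
  let ev (c : 𝒜) : C(characterSpace ℂ 𝒜, ℝ) :=
    ⟨fun φ => (φ c).re, Complex.continuous_re.comp (gelfandTransform ℂ 𝒜 c).continuous⟩
  obtain ⟨g, hg⟩ := exists_comp_eq_of_factorsThrough (f := ev a) (h := ev b) fun φ ψ hφψ => by
    refine congrArg Complex.re (h φ ψ ?_)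
    rw [character_eq_ofReal_re φ ha, character_eq_ofReal_re ψ ha]
    exact congrArg _ hφψ
  refine ⟨g, (gelfandTransform_isometry 𝒜).injective (ContinuousMap.ext fun φ => ?_)⟩
  change φ (cfc g a) = φ b
  rw [character_cfc φ ha g.continuous, character_eq_ofReal_re φ hb]
  exact congrArg _ (DFunLike.congr_fun hg φ)

theorem exists_character_of_mem_spectrum {a : 𝒜} {l : ℝ} (hl : l ∈ spectrum ℝ a) :
    ∃ φ : characterSpace ℂ 𝒜, φ a = l :=
  CharacterSpace.mem_spectrum_iff_exists.1 ((spectrum.algebraMap_mem_iff ℂ).2 hl)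

theorem cantorFunction_mem_Icc {c : ℝ} (h0 : 0 ≤ c) (h1 : c < 1) (d : ℕ → Bool) :
    cantorFunction c d ∈ Set.Icc 0 (1 - c)⁻¹ := by
  refine ⟨tsum_nonneg fun k => cantorFunctionAux_nonneg h0, ?_⟩
  rw [← tsum_geometric_of_lt_one h0 h1]
  refine (cantorFunction_le (g := fun _ => true) h0 h1 fun _ _ => rfl).trans_eq ?_
  exact tsum_congr fun k => cantorFunctionAux_true rfl

section CantorSum

variable {p : ℕ → 𝒜} {c : ℝ} {a : 𝒜}

theorem character_hasSum_isStarProjection (hp : ∀ k, IsStarProjection (p k))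
    (ha : HasSum (fun k => c ^ (k + 1) • p k) a) (h0 : 0 ≤ c) (h1 : c < 1)
    (φ : characterSpace ℂ 𝒜) :
    φ a = (c * cantorFunction c fun k => decide (φ (p k) = 1) : ℝ) := by
  refine (ha.map φ (map_continuous φ)).unique ?_
  have hs := ((summable_cantor_function (fun k => decide (φ (p k) = 1)) h0 h1).hasSum).mul_left c
  convert! Complex.hasSum_ofReal.2 hs using 1
  ext k
  have hk : φ (p k) = 0 ∨ φ (p k) = 1 :=
    IsIdempotentElem.iff_eq_zero_or_one.1 ((hp k).isIdempotentElem.map φ)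
  rw [Function.comp_apply, ← Complex.coe_smul, map_smul, smul_eq_mul]
  rcases hk with hk | hk <;> simp [hk, cantorFunctionAux, pow_succ']

theorem character_eq_of_hasSum_isStarProjection (hp : ∀ k, IsStarProjection (p k))
    (ha : HasSum (fun k => c ^ (k + 1) • p k) a) (h0 : 0 < c) (h1 : c < 1 / 2)
    {φ ψ : characterSpace ℂ 𝒜} (h : φ a = ψ a) (k : ℕ) : φ (p k) = ψ (p k) := by
  have h1' : c < 1 := h1.trans one_half_lt_one
  rw [character_hasSum_isStarProjection hp ha h0.le h1',
    character_hasSum_isStarProjection hp ha h0.le h1', Complex.ofReal_inj] at h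
  have hk := congrFun (cantorFunction_injective h0 h1 (mul_left_cancel₀ h0.ne' h)) k
  have hφ := IsIdempotentElem.iff_eq_zero_or_one.1 ((hp k).isIdempotentElem.map φ)
  have hψ := IsIdempotentElem.iff_eq_zero_or_one.1 ((hp k).isIdempotentElem.map ψ)
  rcases hφ with hφ | hφ <;> rcases hψ with hψ | hψ <;> simp_all

end CantorSum

theorem exists_generator_of_isStarProjection {p : ℕ → 𝒜} (hp : ∀ k, IsStarProjection (p k)) :
    ∃ a : 𝒜, IsSelfAdjoint a ∧ spectrum ℝ a ⊆ Set.Icc 0 1 ∧ ∃ g : ℕ → C(ℝ, ℝ),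
      (∀ k, cfc (g k) a = p k) ∧
      ∀ l ∈ spectrum ℝ a, ∀ l' ∈ spectrum ℝ a, (∀ k, g k l = g k l') → l = l' := by
  have hc : (0 : ℝ) < 1 / 3 ∧ (1 / 3 : ℝ) < 1 / 2 ∧ (1 / 3 : ℝ) < 1 := by norm_num
  obtain ⟨a, ha⟩ : Summable fun k => (1 / 3 : ℝ) ^ (k + 1) • p k := by
    refine .of_norm_bounded ((summable_nat_add_iff 1).2
      (summable_geometric_of_lt_one hc.1.le hc.2.2)) fun k => ?_
    rw [norm_smul, Real.norm_of_nonneg (by positivity)]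
    exact mul_le_of_le_one_right (by positivity) (hp k).norm_le
  have hsa : IsSelfAdjoint a := ha.star.unique (by
    simpa only [star_smul, (hp _).isSelfAdjoint.star_eq, star_trivial] using ha)
  have hg : ∀ k, ∃ g : C(ℝ, ℝ), cfc g a = p k := fun k =>
    exists_cfc_eq_of_forall_character hsa (hp k).isSelfAdjoint fun _ _ h =>
      character_eq_of_hasSum_isStarProjection hp ha hc.1 hc.2.1 h k
  choose g hg using hg
  refine ⟨a, hsa, fun l hl => ?_, g, hg, fun l hl l' hl' h => ?_⟩
  · obtain ⟨φ, hφ⟩ := exists_character_of_mem_spectrum hl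
    rw [character_hasSum_isStarProjection hp ha hc.1.le hc.2.2, Complex.ofReal_inj] at hφ
    have hd := cantorFunction_mem_Icc hc.1.le hc.2.2 fun k => decide (φ (p k) = 1)
    norm_num at hd ⊢
    exact ⟨by linarith, by linarith⟩
  · obtain ⟨φ, hφ⟩ := exists_character_of_mem_spectrum hl
    obtain ⟨ψ, hψ⟩ := exists_character_of_mem_spectrum hl'
    have hφψ : ∀ k, φ (p k) = ψ (p k) := fun k => by
      rw [← hg, character_cfc φ hsa (g k).continuous, character_cfc ψ hsa (g k).continuous, hφ,
        hψ, Complex.ofReal_re, Complex.ofReal_re, h]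
    rw [← Complex.ofReal_inj, ← hφ, ← hψ, character_hasSum_isStarProjection hp ha hc.1.le hc.2.2,
      character_hasSum_isStarProjection hp ha hc.1.le hc.2.2]
    simp only [hφψ]

/-- The closed star subalgebra generated by commuting self-adjoint elements,
as a commutative C⋆-algebra. -/
abbrev commCStarAlgebraOfCommute {𝒜 : Type*} [CStarAlgebra 𝒜] {s : Set 𝒜}
    (hs : ∀ a ∈ s, IsSelfAdjoint a) (hc : ∀ a ∈ s, ∀ b ∈ s, a * b = b * a) :
    CommCStarAlgebra (StarAlgebra.adjoin ℂ s).topologicalClosure :=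
  have : IsMulCommutative (StarAlgebra.adjoin ℂ s) := StarAlgebra.isMulCommutative_adjoin ℂ hc
    fun a ha b hb => by rw [(hs b hb).star_eq]; exact hc a ha b hb
  { StarSubalgebra.cstarAlgebra _ (h_closed := StarSubalgebra.isClosed_topologicalClosure _) with
    mul_comm := (StarSubalgebra.commRingTopologicalClosure _ this.is_comm.comm).mul_comm }

theorem exists_generator_of_commute {𝒜 : Type*} [CStarAlgebra 𝒜] {p : ℕ → 𝒜}
    (hp : ∀ k, IsStarProjection (p k)) (hc : ∀ j k, Commute (p j) (p k)) :
    ∃ (a : 𝒜) (ha : IsSelfAdjoint a), spectrum ℝ a ⊆ Set.Icc 0 1 ∧ ∃ g : ℕ → C(spectrum ℝ a, ℝ),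
      (∀ k, cfcHom ha (g k) = p k) ∧ ∀ l l', (∀ k, g k l = g k l') → l = l' := by
  let S := (StarAlgebra.adjoin ℂ (Set.range p)).topologicalClosure
  have hS : IsClosed (S : Set 𝒜) := StarSubalgebra.isClosed_topologicalClosure _
  let _ : CommCStarAlgebra S := commCStarAlgebraOfCommute
    (by rintro _ ⟨k, rfl⟩; exact (hp k).isSelfAdjoint)
    (by rintro _ ⟨j, rfl⟩ _ ⟨k, rfl⟩; exact hc j k)
  let q : ℕ → S := fun k => ⟨p k, StarSubalgebra.le_topologicalClosure _
    (StarAlgebra.subset_adjoin ℂ _ ⟨k, rfl⟩)⟩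
  obtain ⟨a, ha, hspec, g, hg, hsep⟩ := exists_generator_of_isStarProjection (p := q) fun k =>
    ⟨Subtype.ext (hp k).isIdempotentElem, Subtype.ext (hp k).isSelfAdjoint⟩
  have ha' : IsSelfAdjoint (a : 𝒜) := ha.map S.subtype
  have hσ : spectrum ℝ (a : 𝒜) = spectrum ℝ a := by
    ext l
    rw [← spectrum.algebraMap_mem_iff ℂ, ← spectrum.algebraMap_mem_iff ℂ (a := a),
      S.spectrum_eq]
  refine ⟨a, ha', hσ ▸ hspec, fun k => (g k).restrict _, fun k => ?_, fun l l' h =>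
    Subtype.ext (hsep l (hσ ▸ l.2) l' (hσ ▸ l'.2) h)⟩
  have hk := StarAlgHom.map_cfc (R := ℝ) S.subtype (g k) a (g k).continuous.continuousOn
    continuous_subtype_val ha ha'
  rw [hg] at hk
  exact (cfc_apply (g k) (a : 𝒜) ha' (g k).continuous.continuousOn).symm.trans hk.symm

end Generator

section SeparatingGenerator

variable {H : Type*} [NormedAddCommGroup H] [InnerProductSpace ℂ H] [CompleteSpace H]
  {A B C : H →L[ℂ] H} {hA : IsSelfAdjoint A} {hB : IsSelfAdjoint B} {hC : IsSelfAdjoint C}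

theorem spectralPOVM_cfcHom_hasIntegral (hA : IsSelfAdjoint A) :
    (spectralPOVM (cfcHom hA)).HasIntegral Set.univ (fun l => (l : ℝ)) A := by
  have h := spectralPOVM_hasIntegral (cfcHom hA) ((ContinuousMap.id ℝ).restrict (spectrum ℝ A))
  rwa [cfcHom_id hA] at h

/-- The spectral projection of the self-adjoint operator `B` for the half-line `[q, ∞)`. -/
def levelProjection (hB : IsSelfAdjoint B) (q : ℚ) : H →L[ℂ] H :=
  spectralPOVM (cfcHom hB) (Subtype.val ⁻¹' Set.Ici (q : ℝ))

theorem isStarProjection_levelProjection (q : ℚ) : IsStarProjection (levelProjection hB q) :=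
  ⟨(spectralPOVM_isPVM _).apply_mul_self (measurable_subtype_coe measurableSet_Ici),
    (spectralPOVM _).isSelfAdjoint_apply (measurable_subtype_coe measurableSet_Ici)⟩

theorem commute_levelProjection (h : Commute B C) (q r : ℚ) :
    Commute (levelProjection hB q) (levelProjection hC r) :=
  (isSpectralOperator_spectralPOVM _ (measurable_subtype_coe measurableSet_Ici)).commute _
    fun f => .symm <|
      (isSpectralOperator_spectralPOVM _ (measurable_subtype_coe measurableSet_Ici)).commute _
        fun g => hC.commute_cfcHom hC (hB.commute_cfcHom hB h g).symm f

theorem mem_range_cfcHom_of_forall_levelProjection_mem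
    (h : ∀ q, levelProjection hB q ∈ Set.range (cfcHom (R := ℝ) hA)) :
    B ∈ Set.range (cfcHom (R := ℝ) hA) := by
  have hspan := (spectralPOVM_cfcHom_hasIntegral hB).mem_topologicalClosure_span
    (spectralPOVM_isNormalized _) measurable_subtype_coe
    ((ContinuousMap.id ℝ).restrict (spectrum ℝ B)).norm_coe_le_norm
  refine Submodule.topologicalClosure_minimal
    (t := LinearMap.range (cfcHom (R := ℝ) hA).toAlgHom.toLinearMap) _ (Submodule.span_le.2 ?_)
    (cfcHom_isClosedEmbedding hA).isClosed_range hspan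
  rintro _ ⟨q, rfl⟩
  exact h q

theorem levelProjection_cfcHom {f : C(spectrum ℝ A, ℝ)} (hf : cfcHom hA f = B) (q : ℚ) :
    levelProjection hB q = spectralPOVM (cfcHom hA) (f ⁻¹' Set.Ici (q : ℝ)) := by
  subst hf
  let θ : C(spectrum ℝ A, spectrum ℝ (cfcHom hA f)) :=
    ⟨fun l => ⟨f l, by rw [cfcHom_map_spectrum hA f]; exact ⟨l, rfl⟩⟩, by fun_prop⟩
  refine spectralPOVM_comp (cfcHom hA) θ (fun g => ?_) (measurable_subtype_coe measurableSet_Ici)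
  exact (cfcHom_comp hA f θ (fun _ => rfl) g).symm

theorem ae_eq_indicator_level {f p : C(spectrum ℝ A, ℝ)} (hf : cfcHom hA f = B) {q : ℚ}
    (hp : cfcHom hA p = levelProjection hB q) (x : H) :
    p =ᵐ[(spectralPOVM (cfcHom hA)).scalarMeasure x] (f ⁻¹' Set.Ici (q : ℝ)).indicator 1 := by
  have hi := spectralPOVM_hasIntegral (cfcHom hA) p
  rw [hp, levelProjection_cfcHom hf] at hi
  exact hi.ae_eq (spectralPOVM_isPVM _)
    (POVM.hasIntegral_indicator_one (f.continuous.measurable measurableSet_Ici)) x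

theorem exists_separating_generator {ι : Type*} [Countable ι] [Nonempty ι] {B : ι → H →L[ℂ] H}
    (hB : ∀ i, IsSelfAdjoint (B i)) (hc : ∀ i j, Commute (B i) (B j)) :
    ∃ (A : H →L[ℂ] H) (hA : IsSelfAdjoint A) (f : ι → C(spectrum ℝ A, ℝ)) (Γ : Set (spectrum ℝ A)),
      spectrum ℝ A ⊆ Set.Icc 0 1 ∧ (∀ i, cfcHom hA (f i) = B i) ∧ MeasurableSet Γ ∧
      (∀ x, ∀ᵐ l ∂((spectralPOVM (cfcHom hA)).scalarMeasure x), l ∈ Γ) ∧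
      ∀ l ∈ Γ, ∀ l' ∈ Γ, (∀ i, f i l = f i l') → l = l' := by
  obtain ⟨e, he⟩ := exists_surjective_nat (ι × ℚ)
  obtain ⟨A, hA, hspec, p, hp, hsep⟩ := exists_generator_of_commute
    (p := fun k => levelProjection (hB (e k).1) (e k).2)
    (fun _ => isStarProjection_levelProjection _) fun j k => commute_levelProjection (hc _ _) _ _
  have hf (i : ι) : ∃ f, cfcHom hA f = B i :=
    mem_range_cfcHom_of_forall_levelProjection_mem (hB := hB i) fun q => by
      obtain ⟨k, hk⟩ := he (i, q)
      have hpk := hp k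
      rw [hk] at hpk
      exact ⟨p k, hpk⟩
  choose f hf using hf
  refine ⟨A, hA, f, {l | ∀ k, p k l = (f (e k).1 ⁻¹' Set.Ici ((e k).2 : ℝ)).indicator 1 l}, hspec,
    hf, ?_, fun x => ?_, fun l hl l' hl' h => hsep l l' fun k => ?_⟩
  · rw [Set.ofPred_forall]
    exact .iInter fun k => measurableSet_eq_fun (p k).continuous.measurable
      (measurable_one.indicator ((f _).continuous.measurable measurableSet_Ici))
  · exact ae_all_iff.2 fun k => ae_eq_indicator_level (hf _) (hp k) x
  · rw [hl k, hl' k]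
    simp only [Set.indicator, Set.mem_preimage, h, Pi.one_apply]

end SeparatingGenerator

section RationalDistributionFunctions

theorem tendsto_measureReal_Iic_atBot (ρ : Measure ℝ) [IsFiniteMeasure ρ] :
    Tendsto (fun t => ρ.real (Set.Iic t)) atBot (𝓝 0) := by
  have h := tendsto_measure_iInter_atBot (μ := ρ) (s := fun t : ℝ => Set.Iic t)
    (fun _ => measurableSet_Iic.nullMeasurableSet) (fun _ _ => Set.Iic_subset_Iic.2)
    ⟨0, measure_ne_top _ _⟩
  rw [iInter_Iic_eq_empty_iff.2 (by simp), measure_empty] at h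
  exact (ENNReal.tendsto_toReal ENNReal.zero_ne_top).comp h

theorem tendsto_measureReal_Iic_nhdsGT (ρ : Measure ℝ) [IsFiniteMeasure ρ] (a : ℝ) :
    Tendsto (fun t => ρ.real (Set.Iic t)) (𝓝[>] a) (𝓝 (ρ.real (Set.Iic a))) := by
  have h := tendsto_measure_biInter_gt (μ := ρ) (s := fun t : ℝ => Set.Iic t) (a := a)
    (fun _ _ => measurableSet_Iic.nullMeasurableSet) (fun _ _ _ => Set.Iic_subset_Iic.2)
    ⟨a + 1, by simp, measure_ne_top _ _⟩
  have hInter : ⋂ t > a, Set.Iic t = Set.Iic a := by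
    ext s
    simpa using forall_gt_imp_ge_iff_le_of_dense (a₁ := s) (a₂ := a)
  rw [hInter] at h
  exact (ENNReal.tendsto_toReal (measure_ne_top _ _)).comp h

variable {Λ : Type*} [MeasurableSpace Λ]

/-- `G l` is a candidate for the restriction to `ℚ` of the distribution function of a probability
measure `κ l`, such that `ρ` is the mixture of the `κ l` with respect to `ν`. -/
structure IsRatCDFMixture (ν : Measure Λ) (ρ : Measure ℝ) (G : Λ → ℚ → ℝ) : Prop where
  measurable : Measurable G
  mem_Icc : ∀ l q, G l q ∈ Set.Icc (0 : ℝ) 1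
  monotone : ∀ l, Monotone (G l)
  integral_eq : ∀ q : ℚ, ∫ l, G l q ∂ν = ρ.real (Set.Iic (q : ℝ))
  measure_univ : ν Set.univ = ρ Set.univ

namespace IsRatCDFMixture

variable {ν : Measure Λ} [IsFiniteMeasure ν] {ρ : Measure ℝ} {G : Λ → ℚ → ℝ}

theorem integrable (h : IsRatCDFMixture ν ρ G) (q : ℚ) : Integrable (fun l => G l q) ν :=
  .of_bound (measurable_pi_iff.1 h.measurable q).aestronglyMeasurable 1 <| ae_of_all _ fun l => by
    rw [Real.norm_of_nonneg (h.mem_Icc l q).1]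
    exact (h.mem_Icc l q).2

theorem ae_tendsto_of_antitone (h : IsRatCDFMixture ν ρ G) {u : ℕ → ℚ} (hu : Antitone u)
    {g : Λ → ℝ} (hg : Integrable g ν) (hle : ∀ n l, g l ≤ G l (u n))
    (hlim : Tendsto (fun n => ρ.real (Set.Iic (u n : ℝ))) atTop (𝓝 (∫ l, g l ∂ν))) :
    ∀ᵐ l ∂ν, Tendsto (fun n => G l (u n)) atTop (𝓝 (g l)) :=
  tendsto_of_integral_tendsto_of_antitone (fun n => h.integrable (u n)) hg
    (by simpa only [h.integral_eq] using hlim)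
    (ae_of_all _ fun l => (h.monotone l).comp_antitone hu) (ae_of_all _ fun l n => hle n l)

theorem ae_tendsto_atTop [IsFiniteMeasure ρ] (h : IsRatCDFMixture ν ρ G) :
    ∀ᵐ l ∂ν, Tendsto (G l) atTop (𝓝 1) := by
  have hlim : Tendsto (fun n : ℕ => ∫ l, G l n ∂ν) atTop (𝓝 (∫ _, 1 ∂ν)) := by
    simp only [h.integral_eq, integral_const, smul_eq_mul, mul_one, measureReal_def, h.measure_univ,
      Rat.cast_natCast]
    exact (ENNReal.tendsto_toReal (measure_ne_top _ _)).comp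
      ((tendsto_measure_Iic_atTop ρ).comp tendsto_natCast_atTop_atTop)
  filter_upwards [tendsto_of_integral_tendsto_of_monotone (fun n : ℕ => h.integrable n)
    (integrable_const 1) hlim (ae_of_all _ fun l => (h.monotone l).comp Nat.mono_cast)
    (ae_of_all _ fun l n => (h.mem_Icc l n).2)] with l hl
  exact (tendsto_iff_tendsto_subseq_of_monotone (h.monotone l) tendsto_natCast_atTop_atTop).2 hl

theorem ae_tendsto_atBot [IsFiniteMeasure ρ] (h : IsRatCDFMixture ν ρ G) :
    ∀ᵐ l ∂ν, Tendsto (G l) atBot (𝓝 0) := by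
  have hlim : Tendsto (fun n : ℕ => ρ.real (Set.Iic ((-n : ℚ) : ℝ))) atTop (𝓝 (∫ _, 0 ∂ν)) := by
    rw [integral_zero]
    push_cast
    exact (tendsto_measureReal_Iic_atBot ρ).comp
      (tendsto_neg_atTop_atBot.comp tendsto_natCast_atTop_atTop)
  filter_upwards [h.ae_tendsto_of_antitone (fun _ _ hmn => neg_le_neg (Nat.cast_le.2 hmn))
    (integrable_zero _ _ _) (fun n l => (h.mem_Icc l _).1) hlim] with l hl
  have hanti : Antitone fun q => G l (-q) := (h.monotone l).comp_antitone (fun _ _ => neg_le_neg)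
  simpa [Function.comp_def] using ((tendsto_iff_tendsto_subseq_of_antitone hanti
    tendsto_natCast_atTop_atTop).2 hl).comp tendsto_neg_atBot_atTop

theorem ae_iInf_Ioi_eq [IsFiniteMeasure ρ] (h : IsRatCDFMixture ν ρ G) (q : ℚ) :
    ∀ᵐ l ∂ν, ⨅ r : Set.Ioi q, G l r = G l q := by
  have hpos : ∀ n : ℕ, (0 : ℚ) < 1 / (n + 1) := fun n => by positivity
  have hlim : Tendsto (fun n : ℕ => ρ.real (Set.Iic ((q + 1 / (n + 1) : ℚ) : ℝ))) atTop
      (𝓝 (∫ l, G l q ∂ν)) := by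
    rw [h.integral_eq]
    refine (tendsto_measureReal_Iic_nhdsGT ρ q).comp (tendsto_nhdsWithin_iff.2 ⟨?_, ?_⟩)
    · simpa using (tendsto_one_div_add_atTop_nhds_zero_nat (𝕜 := ℝ)).const_add (q : ℝ)
    · exact Eventually.of_forall fun n =>
        Set.mem_Ioi.2 (Rat.cast_lt.2 (lt_add_of_pos_right q (hpos n)))
  filter_upwards [h.ae_tendsto_of_antitone
    (fun _ _ hmn => add_le_add_right (Nat.one_div_le_one_div hmn) q) (h.integrable q)
    (fun n l => h.monotone l (le_add_of_nonneg_right (hpos n).le)) hlim] with l hl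
  refine le_antisymm (ge_of_tendsto' hl fun n => ?_) (le_ciInf fun r => h.monotone l r.2.le)
  exact ciInf_le ⟨0, Set.forall_mem_range.2 fun r : Set.Ioi q => (h.mem_Icc l r).1⟩
    (⟨_, lt_add_of_pos_right q (hpos n)⟩ : Set.Ioi q)

theorem ae_isRatStieltjesPoint [IsFiniteMeasure ρ] (h : IsRatCDFMixture ν ρ G) :
    ∀ᵐ l ∂ν, IsRatStieltjesPoint G l := by
  filter_upwards [h.ae_tendsto_atTop, h.ae_tendsto_atBot, ae_all_iff.2 h.ae_iInf_Ioi_eq]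
    with l htop hbot hinf using ⟨h.monotone l, htop, hbot, hinf⟩

end IsRatCDFMixture

/-- The Markov kernel with distribution functions `G l` on `ℚ`, wherever `G l` is the restriction
to `ℚ` of a distribution function; elsewhere it takes a default value. -/
def ratCDFKernel (G : Λ → ℚ → ℝ) (hG : Measurable G) : Kernel Λ ℝ where
  toFun l := (stieltjesOfMeasurableRat G hG l).measure
  measurable' := measurable_measure_stieltjesOfMeasurableRat hG

instance (G : Λ → ℚ → ℝ) (hG : Measurable G) : IsMarkovKernel (ratCDFKernel G hG) :=
  ⟨instIsProbabilityMeasure_stieltjesOfMeasurableRat hG⟩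

theorem ratCDFKernel_Iic {G : Λ → ℚ → ℝ} (hG : Measurable G) {l : Λ}
    (hl : IsRatStieltjesPoint G l) (q : ℚ) :
    ratCDFKernel G hG l (Set.Iic (q : ℝ)) = ENNReal.ofReal (G l q) := by
  change (stieltjesOfMeasurableRat G hG l).measure _ = _
  rw [measure_stieltjesOfMeasurableRat_Iic, stieltjesOfMeasurableRat_eq,
    toRatCDF_of_isRatStieltjesPoint hl]

theorem IsRatCDFMixture.bind_ratCDFKernel {ν : Measure Λ} [IsFiniteMeasure ν] {ρ : Measure ℝ}
    [IsFiniteMeasure ρ] {G : Λ → ℚ → ℝ} (h : IsRatCDFMixture ν ρ G) :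
    ν.bind (ratCDFKernel G h.measurable) = ρ := by
  have hκ : AEMeasurable (ratCDFKernel G h.measurable) ν := Kernel.aemeasurable _
  refine ext_of_generate_finite _ Real.borel_eq_generateFrom_Iic_rat Real.isPiSystem_Iic_rat ?_ ?_
  · rintro _ hs
    obtain ⟨q, rfl⟩ := Set.mem_iUnion.1 hs
    calc ν.bind _ (Set.Iic (q : ℝ))
        = ∫⁻ l, ENNReal.ofReal (G l q) ∂ν := by
          rw [Measure.bind_apply measurableSet_Iic hκ]
          exact lintegral_congr_ae (h.ae_isRatStieltjesPoint.mono fun l hl =>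
            ratCDFKernel_Iic h.measurable hl q)
      _ = ρ (Set.Iic (q : ℝ)) := by
          rw [← ofReal_integral_eq_lintegral_ofReal (h.integrable q)
            (ae_of_all _ fun l => (h.mem_Icc l q).1), h.integral_eq, ofReal_measureReal]
  · simp [Measure.bind_apply .univ hκ, h.measure_univ]

end RationalDistributionFunctions

section RationalAlgebra

/-- The algebra of sets generated by the open intervals and the closed left half-lines with rational
end-points: a countable family which contains `rationalRing` and determines a measure. -/
def rationalAlgebra : Set (Set ℝ) :=
  generateSetAlgebra (Set.range (fun i : ℚ × ℚ => Set.Ioo (i.1 : ℝ) (i.2 : ℝ)) ∪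
    Set.range (fun q : ℚ => Set.Iic (q : ℝ)))

theorem countable_rationalAlgebra : rationalAlgebra.Countable :=
  countable_generateSetAlgebra ((Set.countable_range _).union (Set.countable_range _))

theorem Iic_mem_rationalAlgebra (q : ℚ) : Set.Iic (q : ℝ) ∈ rationalAlgebra :=
  self_subset_generateSetAlgebra (.inr ⟨q, rfl⟩)

theorem rationalRing_subset_rationalAlgebra : rationalRing ⊆ rationalAlgebra :=
  Set.sInter_subset_of_mem ⟨isSetAlgebra_generateSetAlgebra.isSetRing,
    fun a b => self_subset_generateSetAlgebra (.inl ⟨(a, b), rfl⟩)⟩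

theorem measurableSet_of_mem_rationalAlgebra {Δ : Set ℝ} (hΔ : Δ ∈ rationalAlgebra) :
    MeasurableSet Δ := by
  induction hΔ with
  | base s hs =>
    rcases hs with ⟨i, rfl⟩ | ⟨q, rfl⟩
    · exact measurableSet_Ioo
    · exact measurableSet_Iic
  | empty => exact .empty
  | compl s _ hs => exact hs.compl
  | union s t _ _ hs ht => exact hs.union ht

end RationalAlgebra

section SharpRepresentation

variable {α Λ : Type*} [MeasurableSpace α] [MeasurableSpace Λ]
  {H : Type*} [NormedAddCommGroup H] [InnerProductSpace ℂ H] [CompleteSpace H]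

namespace POVM

theorem nonneg_of_cfcHom_eq {F : POVM α H} {A : H →L[ℂ] H} {hA : IsSelfAdjoint A} {S : Set α}
    (hS : MeasurableSet S) {f : C(spectrum ℝ A, ℝ)} (hf : cfcHom hA f = F S) : 0 ≤ f := by
  rw [← cfcHom_nonneg_iff hA, hf, ContinuousLinearMap.nonneg_iff_isPositive]
  exact F.isPositive S hS

theorem mono_of_cfcHom_eq {F : POVM α H} {A : H →L[ℂ] H} {hA : IsSelfAdjoint A} {S T : Set α}
    (hS : MeasurableSet S) (hT : MeasurableSet T) (hST : S ⊆ T) {f g : C(spectrum ℝ A, ℝ)}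
    (hf : cfcHom hA f = F S) (hg : cfcHom hA g = F T) : f ≤ g :=
  sub_nonneg.1 <| nonneg_of_cfcHom_eq (F := F) (hT.diff hS) <| by
    rw [map_sub, hf, hg, F.apply_sdiff hS hT hST]

theorem IsNormalized.mem_Icc_of_cfcHom_eq {F : POVM α H} (hF : F.IsNormalized) {A : H →L[ℂ] H}
    {hA : IsSelfAdjoint A} {S : Set α} (hS : MeasurableSet S) {f : C(spectrum ℝ A, ℝ)}
    (hf : cfcHom hA f = F S) (l : spectrum ℝ A) : f l ∈ Set.Icc (0 : ℝ) 1 :=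
  ⟨nonneg_of_cfcHom_eq hS hf l, mono_of_cfcHom_eq hS .univ S.subset_univ hf
    ((map_one (cfcHom hA)).trans hF.symm) l⟩

theorem IsNormalized.isRatCDFMixture {F : POVM ℝ H} (hF : F.IsNormalized) {A : H →L[ℂ] H}
    {hA : IsSelfAdjoint A} {g : ℚ → C(spectrum ℝ A, ℝ)}
    (hg : ∀ q, cfcHom hA (g q) = F (Set.Iic (q : ℝ))) (x : H) :
    IsRatCDFMixture ((spectralPOVM (cfcHom hA)).scalarMeasure x) (F.scalarMeasure x)
      fun l q => g q l where
  measurable := measurable_pi_lambda _ fun q => (g q).continuous.measurable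
  mem_Icc l q := hF.mem_Icc_of_cfcHom_eq measurableSet_Iic (hg q) l
  monotone l q r hqr := mono_of_cfcHom_eq measurableSet_Iic measurableSet_Iic
    (Set.Iic_subset_Iic.2 (Rat.cast_le.2 hqr)) (hg q) (hg r) l
  integral_eq q := by
    have h := (spectralPOVM_hasIntegral (cfcHom hA) (g q) x).2
    rw [hg q, F.inner_apply_self x measurableSet_Iic, Measure.restrict_univ] at h
    exact_mod_cast h.symm
  measure_univ := by
    rw [scalarMeasure_apply _ _ .univ, scalarMeasure_apply _ _ .univ, hF,
      (spectralPOVM_isPVM (cfcHom hA)).2]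

theorem hasIntegral_ratCDFKernel {E : POVM Λ H} {F : POVM ℝ H} {G : Λ → ℚ → ℝ} (hG : Measurable G)
    (h : ∀ x, IsRatCDFMixture (E.scalarMeasure x) (F.scalarMeasure x) G) {Δ : Set ℝ}
    (hΔ : MeasurableSet Δ) :
    E.HasIntegral Set.univ (fun l => (ratCDFKernel G hG l).real Δ) (F Δ) := fun x => by
  have hmeas : Measurable fun l => ratCDFKernel G hG l Δ := Kernel.measurable_coe _ hΔ
  have hint : Integrable (fun l => (ratCDFKernel G hG l).real Δ) (E.scalarMeasure x) :=
    .of_bound hmeas.ennreal_toReal.aestronglyMeasurable 1 <| ae_of_all _ fun l => by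
      rw [Real.norm_of_nonneg measureReal_nonneg]
      exact measureReal_le_one
  refine ⟨hint.integrableOn, ?_⟩
  rw [F.inner_apply_self x hΔ, Measure.restrict_univ, ← (h x).bind_ratCDFKernel, measureReal_def,
    Measure.bind_apply hΔ (Kernel.aemeasurable _),
    ← integral_toReal hmeas.aemeasurable (ae_of_all _ fun l => measure_lt_top _ _)]
  rfl

theorem apply_eq_one_of_ae_mem {E : POVM Λ H} (hE : E.IsNormalized) {Γ : Set Λ}
    (hΓ : MeasurableSet Γ) (hae : ∀ x, ∀ᵐ l ∂(E.scalarMeasure x), l ∈ Γ) : E Γ = 1 :=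
  clm_ext_inner_self fun x => by
    rw [E.inner_apply_self x hΓ, ← hE, E.inner_apply_self x .univ,
      measureReal_congr (s := Γ) (eventuallyEq_univ.2 (hae x))]

theorem HasIntegral.congr_of_ae_mem {E : POVM Λ H} {f g : Λ → ℝ} {B : H →L[ℂ] H}
    (hf : E.HasIntegral Set.univ f B) {Γ : Set Λ}
    (hae : ∀ x, ∀ᵐ l ∂(E.scalarMeasure x), l ∈ Γ) (hfg : Set.EqOn f g Γ) :
    E.HasIntegral Γ g B := fun x => by
  have hfg_ae : f =ᵐ[E.scalarMeasure x] g := (hae x).mono hfg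
  rw [IntegrableOn, Measure.restrict_eq_self_of_ae_mem (hae x), ← integral_congr_ae hfg_ae]
  have h := hf x
  rw [IntegrableOn, Measure.restrict_univ] at h
  exact ⟨h.1.congr hfg_ae, h.2⟩

end POVM

theorem IsWeakMarkovMap.of_ae_eq_kernel {ν : Measure Λ} {μ : Set ℝ → Λ → ℝ} (κ : Kernel Λ ℝ)
    [IsMarkovKernel κ] (hμ : ∀ Δ, MeasurableSet Δ → ∀ l, μ Δ l ∈ Set.Icc (0 : ℝ) 1)
    (hmeas : ∀ Δ, MeasurableSet Δ → Measurable (μ Δ))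
    (hκ : ∀ᵐ l ∂ν, ∀ Δ, MeasurableSet Δ → μ Δ l = (κ l).real Δ) : IsWeakMarkovMap ν μ where
  mem_Icc := hμ
  measurable := hmeas
  univ_ae := hκ.mono fun l hl => by rw [hl _ .univ, probReal_univ]
  empty_ae := hκ.mono fun l hl => by rw [hl _ .empty, measureReal_empty]
  hasSum_ae Δ hΔ hd := hκ.mono fun l hl => by
    simpa only [hl _ (hΔ _), hl _ (.iUnion hΔ)] using hasSum_measureReal_iUnion (κ l) hΔ hd

theorem IsStrongMarkovMap.of_eqOn_kernel {E : POVM Λ H} (hE : E.IsPVM) {μ : Set ℝ → Λ → ℝ}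
    {Γ : Set Λ} (hΓ : MeasurableSet Γ) (hae : ∀ x, ∀ᵐ l ∂(E.scalarMeasure x), l ∈ Γ)
    (κ : Kernel Λ ℝ) [IsMarkovKernel κ]
    (hμ : ∀ Δ, MeasurableSet Δ → ∀ l, μ Δ l ∈ Set.Icc (0 : ℝ) 1)
    (hmeas : ∀ Δ, MeasurableSet Δ → Measurable (μ Δ))
    (hκ : ∀ Δ, MeasurableSet Δ → Set.EqOn (fun l => (κ l).real Δ) (μ Δ) Γ) :
    IsStrongMarkovMap μ E Γ where
  isPVM := hE
  weak x := .of_ae_eq_kernel κ hμ hmeas ((hae x).mono fun _ hl _ hΔ => (hκ _ hΔ hl).symm)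
  measurableSet := hΓ
  apply_eq_one := POVM.apply_eq_one_of_ae_mem hE.2 hΓ hae
  markov := ⟨κ.comap Subtype.val measurable_subtype_coe, inferInstance,
    fun _ hΔ l => (hκ _ hΔ l.2).symm⟩

/-- The Markov map given by the kernel `κ`, with its values on `rationalAlgebra` replaced by the
functions `f`. -/
def replaceOnRationalAlgebra (f : rationalAlgebra → Λ → ℝ) (κ : Kernel Λ ℝ) : Set ℝ → Λ → ℝ :=
  Function.extend Subtype.val f fun Δ l => (κ l).real Δ

section Replace

variable {f : rationalAlgebra → Λ → ℝ} {κ : Kernel Λ ℝ}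

theorem replaceOnRationalAlgebra_of_mem {Δ : Set ℝ} (hΔ : Δ ∈ rationalAlgebra) :
    replaceOnRationalAlgebra f κ Δ = f ⟨Δ, hΔ⟩ :=
  Subtype.val_injective.extend_apply f _ ⟨Δ, hΔ⟩

theorem replaceOnRationalAlgebra_of_notMem {Δ : Set ℝ} (hΔ : Δ ∉ rationalAlgebra) :
    replaceOnRationalAlgebra f κ Δ = fun l => (κ l).real Δ :=
  Function.extend_apply' _ _ _ fun ⟨Δ', h⟩ => hΔ (h ▸ Δ'.2)

theorem replaceOnRationalAlgebra_mem_Icc [IsMarkovKernel κ]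
    (hf : ∀ Δ l, f Δ l ∈ Set.Icc (0 : ℝ) 1) (Δ : Set ℝ) (l : Λ) :
    replaceOnRationalAlgebra f κ Δ l ∈ Set.Icc (0 : ℝ) 1 := by
  by_cases hΔ : Δ ∈ rationalAlgebra
  · rw [replaceOnRationalAlgebra_of_mem hΔ]
    exact hf _ l
  · rw [replaceOnRationalAlgebra_of_notMem hΔ]
    exact ⟨measureReal_nonneg, measureReal_le_one⟩

theorem measurable_replaceOnRationalAlgebra (hf : ∀ Δ, Measurable (f Δ)) {Δ : Set ℝ}
    (hΔ : MeasurableSet Δ) : Measurable (replaceOnRationalAlgebra f κ Δ) := by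
  by_cases h : Δ ∈ rationalAlgebra
  · rw [replaceOnRationalAlgebra_of_mem h]
    exact hf _
  · rw [replaceOnRationalAlgebra_of_notMem h]
    exact (κ.measurable_coe hΔ).ennreal_toReal

theorem replaceOnRationalAlgebra_eqOn {Γ : Set Λ}
    (h : ∀ Δ : rationalAlgebra, Set.EqOn (fun l => (κ l).real Δ) (f Δ) Γ) (Δ : Set ℝ) :
    Set.EqOn (fun l => (κ l).real Δ) (replaceOnRationalAlgebra f κ Δ) Γ := by
  by_cases hΔ : Δ ∈ rationalAlgebra
  · rw [replaceOnRationalAlgebra_of_mem hΔ]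
    exact h ⟨Δ, hΔ⟩
  · rw [replaceOnRationalAlgebra_of_notMem hΔ]
    exact Set.eqOn_refl _ _

end Replace

theorem isSharpRepresentation_replaceOnRationalAlgebra {F : POVM ℝ H} (hF : F.IsNormalized)
    {A : H →L[ℂ] H} (hA : IsSelfAdjoint A) (hspec : spectrum ℝ A ⊆ Set.Icc 0 1)
    {f : rationalAlgebra → C(spectrum ℝ A, ℝ)} (hf : ∀ Δ, cfcHom hA (f Δ) = F Δ)
    {κ : Kernel (spectrum ℝ A) ℝ} [IsMarkovKernel κ]
    (hκ : ∀ Δ, MeasurableSet Δ →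
      (spectralPOVM (cfcHom hA)).HasIntegral Set.univ (fun l => (κ l).real Δ) (F Δ))
    {Γ : Set (spectrum ℝ A)} (hΓ : MeasurableSet Γ)
    (hae : ∀ x, ∀ᵐ l ∂((spectralPOVM (cfcHom hA)).scalarMeasure x), l ∈ Γ)
    (hfκ : ∀ Δ : rationalAlgebra, Set.EqOn (fun l => (κ l).real Δ) (f Δ) Γ)
    (hsep : ∀ l ∈ Γ, ∀ l' ∈ Γ, (∀ Δ, f Δ l = f Δ l') → l = l') :
    IsSharpRepresentation F A (spectralPOVM (cfcHom hA))
      (replaceOnRationalAlgebra (fun Δ => f Δ) κ) Γ where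
  isSelfAdjoint := hA
  spectrum_subset := hspec
  eq_integral := spectralPOVM_cfcHom_hasIntegral hA
  strong := .of_eqOn_kernel (spectralPOVM_isPVM _) hΓ hae κ
    (fun Δ _ => replaceOnRationalAlgebra_mem_Icc
      (fun Δ => hF.mem_Icc_of_cfcHom_eq (measurableSet_of_mem_rationalAlgebra Δ.2) (hf Δ)) Δ)
    (fun _ => measurable_replaceOnRationalAlgebra fun Δ => (f Δ).continuous.measurable)
    fun Δ _ => replaceOnRationalAlgebra_eqOn hfκ Δ
  continuous Δ hΔ := by
    rw [replaceOnRationalAlgebra_of_mem (rationalRing_subset_rationalAlgebra hΔ)]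
    exact (f _).continuous
  smearing Δ hΔ := (hκ Δ hΔ).congr_of_ae_mem hae (replaceOnRationalAlgebra_eqOn hfκ Δ)
  separates l hl l' hl' hne := by
    contrapose! hne
    refine hsep l hl l' hl' fun Δ => ?_
    have h := hne Δ (measurableSet_of_mem_rationalAlgebra Δ.2)
    rwa [replaceOnRationalAlgebra_of_mem Δ.2] at h

theorem exists_isSharpRepresentation {F : POVM ℝ H} (hF : F.IsNormalized) (hc : F.IsCommutative) :
    ∃ (A : H →L[ℂ] H) (E : POVM (spectrum ℝ A) H) (μ : Set ℝ → spectrum ℝ A → ℝ)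
      (Γ : Set (spectrum ℝ A)), IsSharpRepresentation F A E μ Γ := by
  have : Countable rationalAlgebra := countable_rationalAlgebra.to_subtype
  have : Nonempty rationalAlgebra := ⟨⟨_, Iic_mem_rationalAlgebra 0⟩⟩
  have hmeas (Δ : rationalAlgebra) : MeasurableSet (Δ : Set ℝ) :=
    measurableSet_of_mem_rationalAlgebra Δ.2
  obtain ⟨A, hA, f, Γ₀, hspec, hf, hΓ₀, hae, hsep⟩ := exists_separating_generator
    (fun Δ : rationalAlgebra => F.isSelfAdjoint_apply (hmeas Δ))
    fun Δ Δ' => hc _ _ (hmeas Δ) (hmeas Δ')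
  have hmix := hF.isRatCDFMixture fun q => hf ⟨_, Iic_mem_rationalAlgebra q⟩
  let κ := ratCDFKernel _ (hmix 0).measurable
  have hκ : ∀ Δ, MeasurableSet Δ →
      (spectralPOVM (cfcHom hA)).HasIntegral Set.univ (fun l => (κ l).real Δ) (F Δ) :=
    fun _ => POVM.hasIntegral_ratCDFKernel _ hmix
  have hagree (Δ : rationalAlgebra) (x : H) :
      ∀ᵐ l ∂((spectralPOVM (cfcHom hA)).scalarMeasure x), (κ l).real Δ = f Δ l :=
    POVM.HasIntegral.ae_eq (spectralPOVM_isPVM _) (hκ Δ (hmeas Δ))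
      (hf Δ ▸ spectralPOVM_hasIntegral _ (f Δ)) x
  refine ⟨A, _, _, Γ₀ ∩ ⋂ Δ : rationalAlgebra, {l | (κ l).real Δ = f Δ l},
    isSharpRepresentation_replaceOnRationalAlgebra hF hA hspec hf hκ ?_ (fun x => ?_)
      (fun Δ l hl => Set.mem_iInter.1 hl.2 Δ) fun l hl l' hl' => hsep l hl.1 l' hl'.1⟩
  · exact hΓ₀.inter (.iInter fun Δ => measurableSet_eq_fun
      (κ.measurable_coe (hmeas Δ)).ennreal_toReal (f Δ).continuous.measurable)
  · filter_upwards [hae x, ae_all_iff.2 fun Δ => hagree Δ x] with l hl hl'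
    exact ⟨hl, Set.mem_iInter.2 hl'⟩

end SharpRepresentation

end

theorem theorem4p3 {H : Type*} [NormedAddCommGroup H] [InnerProductSpace ℂ H] [CompleteSpace H]
    (F : POVM ℝ H) (hF : F.IsNormalized) :
    (F.IsCommutative ↔
      ∃ (A : H →L[ℂ] H) (E : POVM (spectrum ℝ A) H) (μ : Set ℝ → spectrum ℝ A → ℝ)
        (Γ : Set (spectrum ℝ A)), IsSharpRepresentation F A E μ Γ) ∧
    ∀ (A : H →L[ℂ] H) (E : POVM (spectrum ℝ A) H) (μ : Set ℝ → spectrum ℝ A → ℝ)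
      (Γ : Set (spectrum ℝ A)), IsSharpRepresentation F A E μ Γ →
        IsFellerMarkovMap (fun Δ (l : Γ) => μ Δ l) :=
  ⟨⟨exists_isSharpRepresentation hF, fun ⟨_, _, _, _, h⟩ => h.isCommutative⟩,
    fun _ _ _ _ h => h.isFellerMarkovMap⟩
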